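/- Let $F$ be a field of prime characteristic $p$ and let $(L,[p])$ be a finite-dimensional restricted Lie algebra over $F$, i.e. a Lie algebra with a map $x\mapsto x^{[p]}$ on $L$ such that $\operatorname{ad} a^{[p]}=(\operatorname{ad} a)^p$, $(\alpha a)^{[p]}=\alpha^p a^{[p]}$ and $(a+b)^{[p]}=a^{[p]}+b^{[p]}+\sum_{i=1}^{p-1}s_i(a,b)$ for all $\alpha\in F$ and $a,b\in L$, where the $s_i(a,b)\in L$ are given by $(\operatorname{ad}(a\otimes X+b\otimes 1))^{p-1}(a\otimes 1)=\sum_{i=1}^{p-1} i\,s_i(a,b)\otimes X^{i-1}$ in $L\otimes_F F[X]$. Let $S\in L^*$ be a linear form, let $H\subseteq L$ be a $p$-subalgebra (a Lie subalgebra with $x^{[p]}\in H$ for all $x\in H$), and let $M$ be a finite-dimensional $H$-module with character $S|_H$, i.e. its representation $\rho$ satisfies $\rho(x)^p-\rho(x^{[p]})=S(x)^p\,\mathrm{id}_M$ for all $x\in H$. Let $u(L,S)$ be the $S$-reduced universal enveloping algebra of $L$, that is, the quotient of the universal enveloping algebra $U(L)$ by the two-sided ideal generated by all $x^p-x^{[p]}-S(x)^p\cdot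 1$, $x\in L$, and define $u(H,S|_H)$ likewise. Regard $u(L,S)$ as a right $u(H,S|_H)$-module through the canonical homomorphism $u(H,S|_H)\to u(L,S)$ and $M$ as a left $u(H,S|_H)$-module, and let $$\operatorname{Ind}_H^L(M,S)=u(L,S)\otimes_{u(H,S|_H)}M .$$ Then $\operatorname{Ind}_H^L(M,S)$ is finite-dimensional over $F$ and $$\dim_F \operatorname{Ind}_H^L(M,S)=p^{\dim_F L/H}\cdot\dim_F M .$$ -/

import Mathlib

open scoped TensorProduct Polynomial

section RestrictedLie

attribute [local instance 100] LieRing.ofAssociativeRing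

/-- `pm` (written `x ↦ x^[p]`) is a `p`-mapping on the Lie algebra `L` over `F`.
The elements `s i` for `1 ≤ i ≤ p - 1` are determined by their defining polynomial identity in
`F[X] ⊗ L`, since these `i` are invertible in a field `F` of characteristic `p`. -/
structure IsPMapping (F : Type*) {L : Type*} [Field F] [LieRing L] [LieAlgebra F L]
    (p : ℕ) (pm : L → L) : Prop where
  ad_pm : ∀ a : L, LieAlgebra.ad F L (pm a) = (LieAlgebra.ad F L a) ^ p
  pm_smul : ∀ (c : F) (a : L), pm (c • a) = c ^ p • pm a
  pm_add : ∀ a b : L, ∃ s : ℕ → L,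
    ((LieAlgebra.ad F[X] (F[X] ⊗[F] L)
        ((Polynomial.X : F[X]) ⊗ₜ[F] a + (1 : F[X]) ⊗ₜ[F] b)) ^ (p - 1)) ((1 : F[X]) ⊗ₜ[F] a)
      = ∑ i ∈ Finset.Icc 1 (p - 1), ((Polynomial.X : F[X]) ^ (i - 1)) ⊗ₜ[F] (i • s i) ∧
    pm (a + b) = pm a + pm b + ∑ i ∈ Finset.Icc 1 (p - 1), s i

/-- A Lie subalgebra closed under the `p`-mapping. -/
def IsPSubalgebra {F L : Type*} [Field F] [LieRing L] [LieAlgebra F L]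
    (pm : L → L) (H : LieSubalgebra F L) : Prop :=
  ∀ x ∈ H, pm x ∈ H

/-- The `p`-mapping of a `p`-subalgebra. -/
def IsPSubalgebra.restrict {F L : Type*} [Field F] [LieRing L] [LieAlgebra F L]
    {pm : L → L} {H : LieSubalgebra F L} (hH : IsPSubalgebra pm H) : H → H :=
  fun x => ⟨pm x, hH x x.2⟩

/-- The restriction `S|_H` of a linear form. -/
def restrictForm {F L : Type*} [Field F] [LieRing L] [LieAlgebra F L]
    (S : Module.Dual F L) (H : LieSubalgebra F L) : Module.Dual F H :=
  S ∘ₗ H.toSubmodule.subtype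

/-- The `L`-module `M`, with representation `ρ`, has character `S`:
`ρ(x)^p - ρ(x^[p]) = S(x)^p • id` for all `x`. -/
def HasCharacter {F L : Type*} [Field F] [LieRing L] [LieAlgebra F L]
    (p : ℕ) (pm : L → L) (S : Module.Dual F L)
    (M : Type*) [AddCommGroup M] [Module F M] [LieRingModule L M] [LieModule F L M] : Prop :=
  ∀ x : L, (LieModule.toEnd F L M x) ^ p - LieModule.toEnd F L M (pm x)
    = (S x) ^ p • (1 : Module.End F M)

/-- The relations `x^p - x^[p] = S(x)^p` imposed on the universal enveloping algebra. -/
inductive ReducedRel {F L : Type*} [Field F] [LieRing L] [LieAlgebra F L]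
    (p : ℕ) (pm : L → L) (S : Module.Dual F L) :
    UniversalEnvelopingAlgebra F L → UniversalEnvelopingAlgebra F L → Prop
  | rel (x : L) : ReducedRel p pm S
      ((UniversalEnvelopingAlgebra.ι F x) ^ p - UniversalEnvelopingAlgebra.ι F (pm x))
      (algebraMap F (UniversalEnvelopingAlgebra F L) ((S x) ^ p))

/-- The `S`-reduced universal enveloping algebra `u(L, S)`: the quotient of `U(L)` by the two-sided
ideal generated by the elements `x^p - x^[p] - S(x)^p`. -/
abbrev ReducedEnveloping {F L : Type*} [Field F] [LieRing L] [LieAlgebra F L]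
    (p : ℕ) (pm : L → L) (S : Module.Dual F L) : Type _ :=
  RingQuot (ReducedRel p pm S)

namespace ReducedEnveloping

variable {F L : Type*} [Field F] [LieRing L] [LieAlgebra F L]
  (p : ℕ) (pm : L → L) (S : Module.Dual F L)

/-- The canonical Lie algebra homomorphism `L → u(L, S)`. -/
noncomputable def ι : L →ₗ⁅F⁆ ReducedEnveloping p pm S :=
  ((RingQuot.mkAlgHom F (ReducedRel p pm S)) :
    UniversalEnvelopingAlgebra F L →ₗ⁅F⁆ ReducedEnveloping p pm S).comp
      (UniversalEnvelopingAlgebra.ι F)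

theorem ι_apply (x : L) : ι p pm S x =
    RingQuot.mkAlgHom F (ReducedRel p pm S) (UniversalEnvelopingAlgebra.ι F x) := rfl

theorem ι_pow_sub (x : L) :
    (ι p pm S x) ^ p - ι p pm S (pm x)
      = algebraMap F (ReducedEnveloping p pm S) ((S x) ^ p) := by
  rw [ι_apply, ι_apply, ← map_pow, ← map_sub, RingQuot.mkAlgHom_rel F (ReducedRel.rel x),
    AlgHom.commutes]

variable {p pm S}

/-- Existence in the universal property of `u(L, S)`. -/
noncomputable def lift {A : Type*} [Ring A] [Algebra F A] (f : L →ₗ⁅F⁆ A)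
    (hf : ∀ x : L, (f x) ^ p - f (pm x) = algebraMap F A ((S x) ^ p)) :
    ReducedEnveloping p pm S →ₐ[F] A :=
  RingQuot.liftAlgHom F ⟨UniversalEnvelopingAlgebra.lift F f, by
    rintro _ _ ⟨x⟩
    rw [map_sub, map_pow, UniversalEnvelopingAlgebra.lift_ι_apply,
      UniversalEnvelopingAlgebra.lift_ι_apply, AlgHom.commutes, hf]⟩

theorem lift_ι {A : Type*} [Ring A] [Algebra F A] (f : L →ₗ⁅F⁆ A)
    (hf : ∀ x : L, (f x) ^ p - f (pm x) = algebraMap F A ((S x) ^ p)) (x : L) :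
    lift f hf (ι p pm S x) = f x := by
  rw [ι_apply, lift, RingQuot.liftAlgHom_mkAlgHom_apply, UniversalEnvelopingAlgebra.lift_ι_apply]

/-- Uniqueness in the universal property of `u(L, S)`. -/
theorem hom_ext {A : Type*} [Ring A] [Algebra F A] {g₁ g₂ : ReducedEnveloping p pm S →ₐ[F] A}
    (h : ∀ x : L, g₁ (ι p pm S x) = g₂ (ι p pm S x)) : g₁ = g₂ := by
  apply RingQuot.ringQuot_ext'
  apply UniversalEnvelopingAlgebra.hom_ext
  ext x
  exact h x

end ReducedEnveloping

/-- The canonical homomorphism `u(H, S|_H) → u(L, S)` for a `p`-subalgebra `H`. -/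
noncomputable def reducedInclusion {F L : Type*} [Field F] [LieRing L] [LieAlgebra F L]
    (p : ℕ) {pm : L → L} (S : Module.Dual F L) {H : LieSubalgebra F L}
    (hH : IsPSubalgebra pm H) :
    ReducedEnveloping p hH.restrict (restrictForm S H) →ₐ[F] ReducedEnveloping p pm S :=
  ReducedEnveloping.lift ((ReducedEnveloping.ι p pm S).comp H.incl)
    (fun x => ReducedEnveloping.ι_pow_sub p pm S (x : L))

/-- The action of `u(L, S)` on an `L`-module with character `S`. -/
noncomputable def HasCharacter.action {F L : Type*} [Field F] [LieRing L] [LieAlgebra F L]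
    {p : ℕ} {pm : L → L} {S : Module.Dual F L}
    {M : Type*} [AddCommGroup M] [Module F M] [LieRingModule L M] [LieModule F L M]
    (hM : HasCharacter p pm S M) : ReducedEnveloping p pm S →ₐ[F] Module.End F M :=
  ReducedEnveloping.lift (LieModule.toEnd F L M)
    (fun x => (hM x).trans (Algebra.algebraMap_eq_smul_one _).symm)

/-- The left `A`-submodule of `A ⊗_F M` generated by the elements `(a b) ⊗ m - a ⊗ (b m)`, where
`b ∈ B` acts on `A` from the right through `φ : B → A` and on `M` through `ρ : B → End M`. -/
def balancedRelations {F A B M : Type*} [Field F] [Ring A] [Algebra F A] [Ring B] [Algebra F B]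
    [AddCommGroup M] [Module F M] (φ : B →ₐ[F] A) (ρ : B →ₐ[F] Module.End F M) :
    Submodule A (A ⊗[F] M) :=
  Submodule.span A {t | ∃ (a : A) (b : B) (m : M), t = (a * φ b) ⊗ₜ[F] m - a ⊗ₜ[F] (ρ b m)}

/-- The generators already span `balancedRelations` over `F`, so that the quotient below is
the usual tensor product over `B`. -/
theorem balancedRelations_restrictScalars {F A B M : Type*} [Field F] [Ring A] [Algebra F A]
    [Ring B] [Algebra F B] [AddCommGroup M] [Module F M]
    (φ : B →ₐ[F] A) (ρ : B →ₐ[F] Module.End F M) :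
    (balancedRelations φ ρ).restrictScalars F =
      Submodule.span F {t | ∃ (a : A) (b : B) (m : M),
        t = (a * φ b) ⊗ₜ[F] m - a ⊗ₜ[F] (ρ b m)} := by
  apply le_antisymm
  · intro t ht
    have ht' : t ∈ balancedRelations φ ρ := ht
    unfold balancedRelations at ht'
    induction ht' using Submodule.span_induction with
    | mem x hx => exact Submodule.subset_span hx
    | zero => exact Submodule.zero_mem _
    | add x y hx hy ihx ihy => exact Submodule.add_mem _ (ihx hx) (ihy hy)
    | smul c x hx ih =>
      have h := ih hx
      clear ih hx ht
      induction h using Submodule.span_induction with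
      | mem x hx =>
        obtain ⟨a, b, m, rfl⟩ := hx
        refine Submodule.subset_span ⟨c * a, b, m, ?_⟩
        rw [smul_sub, TensorProduct.smul_tmul', TensorProduct.smul_tmul', smul_eq_mul,
          smul_eq_mul, mul_assoc]
      | zero => rw [smul_zero]; exact Submodule.zero_mem _
      | add x y _ _ ihx ihy => rw [smul_add]; exact Submodule.add_mem _ ihx ihy
      | smul r x _ ih => rw [smul_comm]; exact Submodule.smul_mem _ _ ih
  · rw [Submodule.span_le]
    intro t ht
    exact Submodule.subset_span ht

/-- The tensor product `A ⊗_B M` over a possibly noncommutative `F`-algebra `B`, as a left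
`A`-module, where `A` is a right `B`-module through `φ` and `M` a left `B`-module through `ρ`. -/
abbrev TensorOver {F A B M : Type*} [Field F] [Ring A] [Algebra F A] [Ring B] [Algebra F B]
    [AddCommGroup M] [Module F M] (φ : B →ₐ[F] A) (ρ : B →ₐ[F] Module.End F M) : Type _ :=
  (A ⊗[F] M) ⧸ balancedRelations φ ρ

/-- The induced module `Ind_H^L(M, S) = u(L, S) ⊗_{u(H, S|_H)} M`. -/
abbrev InducedModule {F L : Type*} [Field F] [LieRing L] [LieAlgebra F L]
    {p : ℕ} {pm : L → L} (S : Module.Dual F L) {H : LieSubalgebra F L} (hH : IsPSubalgebra pm H)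
    {M : Type*} [AddCommGroup M] [Module F M] [LieRingModule H M] [LieModule F H M]
    (hM : HasCharacter p hH.restrict (restrictForm S H) M) : Type _ :=
  TensorOver (reducedInclusion p S hH) hM.action

end RestrictedLie

/-! ### Bergman's diamond lemma for free algebras. -/

section DiamondLemma

/-! The theorem rests on a Poincaré–Birkhoff–Witt theorem for `u(L, S)`: for an ordered basis of
`L`, the nondecreasing monomials with all exponents below `p` form a basis. Spanning follows by
rewriting with `e_j e_i → e_i e_j + [e_j, e_i]` and `e_i^p → e_i^[p] + S(e_i)^p`. For independence,
`reducedSystem_confluent` shows that this rewriting is confluent. The ambiguity `e_k e_j e_i`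
resolves by the Jacobi identity; `e_j e_i^p` and `e_j^p e_i` resolve by `ad a^[p] = (ad a)^p`, since
`(ad a)^(p-1)` is `∑ a^k (·) a^(p-1-k)` in characteristic `p`; and `e_i^(p+r)` resolves by `[a^[p],
a] = 0`.

Confluence makes the irreducible words independent in a quotient of the free algebra. To map `u(L,
S)` there, the relation `x^p - x^[p] = S(x)^p` is needed for every `x`, not only on the basis.
Jacobson's formula (`IsPMapping.map_add_pow`) makes `x^p - x^[p]` additive and so closes this gap.

Take a basis of `L` in which a complement of `H` comes before a basis of `H`. Each basis monomial is
then a complement monomial times an element from `u(H, S|_H)`, so the `p^(dim L/H)` complement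
monomials generate `u(L, S)` as a right module. Comparing dimensions makes them a free basis
(`exists_freeRightMap_bijective`). Hence the tensor product is a direct sum of that many copies of
`M`. -/

/-- The monomial of a word in a free algebra. -/
noncomputable def freeWord (F : Type*) {ι : Type*} [CommSemiring F] (l : List ι) : FreeAlgebra F ι :=
  (l.map (FreeAlgebra.ι F)).prod

section

variable {F ι : Type*} [CommSemiring F]

@[simp] theorem freeWord_nil : freeWord F ([] : List ι) = 1 := rfl

theorem freeWord_append (x y : List ι) :
    freeWord F (x ++ y) = freeWord F x * freeWord F y := by
  simp [freeWord]

theorem freeWord_cons (i : ι) (x : List ι) :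
    freeWord F (i :: x) = freeWord F [i] * freeWord F x := by
  simp [freeWord]

theorem freeWord_replicate (i : ι) (n : ℕ) :
    freeWord F (List.replicate n i) = freeWord F [i] ^ n := by
  simp [freeWord]

theorem basisFreeMonoid_apply (l : List ι) :
    FreeAlgebra.basisFreeMonoid F ι (FreeMonoid.ofList l) = freeWord F l := by
  apply FreeAlgebra.equivMonoidAlgebraFreeMonoid.injective
  have h : ∀ l : List ι, FreeAlgebra.equivMonoidAlgebraFreeMonoid (freeWord F l)
      = MonoidAlgebra.of F (FreeMonoid ι) (FreeMonoid.ofList l) := by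
    intro l
    induction l with
    | nil => simp [MonoidAlgebra.one_def]
    | cons i l ih =>
      rw [freeWord_cons, map_mul, ih, FreeMonoid.ofList_cons, map_mul]
      simp [freeWord, FreeAlgebra.equivMonoidAlgebraFreeMonoid]
  rw [h]
  simp [FreeAlgebra.basisFreeMonoid]

variable (F ι) in
/-- Words form a basis of a free algebra. -/
noncomputable def freeWordBasis : Module.Basis (List ι) F (FreeAlgebra F ι) :=
  (FreeAlgebra.basisFreeMonoid F ι).reindex FreeMonoid.toList

@[simp] theorem freeWordBasis_apply (l : List ι) : freeWordBasis F ι l = freeWord F l := by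
  rw [freeWordBasis, Module.Basis.reindex_apply]
  exact basisFreeMonoid_apply l

end

/-- A rewriting system on a free algebra, compatible with a well-founded order on words. -/
structure RewritingSystem (F ι σ : Type*) [Field F] where
  lt : List ι → List ι → Prop
  wf : WellFounded lt
  mul : ∀ {a b} (x y), lt a b → lt (x ++ a ++ y) (x ++ b ++ y)
  lead : σ → List ι
  tail : σ → FreeAlgebra F ι
  tail_mem : ∀ s, tail s ∈ Submodule.span F (freeWord F '' {v | lt v (lead s)})

namespace RewritingSystem

variable {F ι σ : Type*} [Field F] (W : RewritingSystem F ι σ)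

/-- The relation attached to a rule. -/
noncomputable def rel (s : σ) : FreeAlgebra F ι := freeWord F (W.lead s) - W.tail s

/-- The span of all instances of rules whose leading word is smaller than `w`. -/
noncomputable def below (w : List ι) : Submodule F (FreeAlgebra F ι) :=
  Submodule.span F {r | ∃ s x y, W.lt (x ++ W.lead s ++ y) w ∧
    r = freeWord F x * W.rel s * freeWord F y}

/-- No leading word occurs in `w`. -/
def Irreducible (w : List ι) : Prop := ∀ s x y, w ≠ x ++ W.lead s ++ y

variable {W} in
theorem mem_below {s : σ} {x y w : List ι} (h : W.lt (x ++ W.lead s ++ y) w) :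
    freeWord F x * W.rel s * freeWord F y ∈ W.below w :=
  Submodule.subset_span ⟨s, x, y, h, rfl⟩

variable {W} in
theorem below_mul {v : List ι} {m : FreeAlgebra F ι} (hm : m ∈ W.below v) (x y : List ι) :
    freeWord F x * m * freeWord F y ∈ W.below (x ++ v ++ y) := by
  induction hm using Submodule.span_induction with
  | mem m h =>
    obtain ⟨s, x', y', h, rfl⟩ := h
    have := mem_below (F := F) (W := W) (s := s) (x := x ++ x') (y := y' ++ y) (w := x ++ v ++ y)
      (by simpa using W.mul x y h)
    simpa [freeWord_append, mul_assoc] using this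
  | zero => simp
  | add a b _ _ ha hb => rw [mul_add, add_mul]; exact add_mem ha hb
  | smul c a _ ha => rw [mul_smul_comm, smul_mul_assoc]; exact Submodule.smul_mem _ _ ha

theorem mul_tail_mul_mem (s : σ) (x y : List ι) :
    freeWord F x * W.tail s * freeWord F y ∈
      Submodule.span F (freeWord F '' {v | W.lt v (x ++ W.lead s ++ y)}) := by
  have h := W.tail_mem s
  generalize W.tail s = m at h ⊢
  induction h using Submodule.span_induction with
  | mem m h =>
    obtain ⟨v, hv, rfl⟩ := h
    rw [← freeWord_append, ← freeWord_append]
    exact Submodule.subset_span ⟨_, W.mul x y hv, rfl⟩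
  | zero => simp
  | add a b _ _ ha hb => rw [mul_add, add_mul]; exact add_mem ha hb
  | smul c a _ ha => rw [mul_smul_comm, smul_mul_assoc]; exact Submodule.smul_mem _ _ ha

open Classical in
/-- The normal form of a word. -/
noncomputable def nfWord : List ι → FreeAlgebra F ι :=
  W.wf.fix fun w rec =>
    if h : ∃ t : σ × List ι × List ι, w = t.2.1 ++ W.lead t.1 ++ t.2.2 then
      -- The recursion is available only below `w`. The value `0` elsewhere is never used, because
      -- the rewritten element is supported on words below `w`.
      (freeWordBasis F ι).constr F (fun v => if hv : W.lt v w then rec v hv else 0)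
        (freeWord F h.choose.2.1 * W.tail h.choose.1 * freeWord F h.choose.2.2)
    else freeWord F w

/-- The normal form map. -/
noncomputable def nf : FreeAlgebra F ι →ₗ[F] FreeAlgebra F ι :=
  (freeWordBasis F ι).constr F W.nfWord

theorem nf_freeWord (w : List ι) : W.nf (freeWord F w) = W.nfWord w := by
  rw [nf, ← freeWordBasis_apply, Module.Basis.constr_basis]

theorem nf_of_irreducible {w : List ι} (hw : W.Irreducible w) :
    W.nf (freeWord F w) = freeWord F w := by
  rw [nf_freeWord, nfWord, WellFounded.fix_eq, dif_neg]
  rintro ⟨⟨s, x, y⟩, h⟩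
  exact hw s x y h

theorem nf_of_reducible {w : List ι} (hw : ¬ W.Irreducible w) :
    ∃ s x y, w = x ++ W.lead s ++ y ∧
      W.nf (freeWord F w) = W.nf (freeWord F x * W.tail s * freeWord F y) := by
  classical
  have h : ∃ t : σ × List ι × List ι, w = t.2.1 ++ W.lead t.1 ++ t.2.2 := by
    simpa [Irreducible] using hw
  refine ⟨h.choose.1, h.choose.2.1, h.choose.2.2, h.choose_spec, ?_⟩
  rw [nf_freeWord, nfWord, WellFounded.fix_eq, dif_pos h]
  have hm := W.mul_tail_mul_mem h.choose.1 h.choose.2.1 h.choose.2.2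
  rw [← h.choose_spec] at hm
  refine LinearMap.eqOn_span (f := (freeWordBasis F ι).constr F _) (g := W.nf) ?_ hm
  rintro _ ⟨v, hv, rfl⟩
  simp only [Set.mem_ofPred_eq] at hv
  rw [← freeWordBasis_apply, Module.Basis.constr_basis, dif_pos hv, freeWordBasis_apply,
    nf_freeWord]
  rfl

/-- All ambiguities are resolvable relative to the order. -/
def Confluent : Prop := ∀ s t x y x' y', x ++ W.lead s ++ y = x' ++ W.lead t ++ y' →
  freeWord F x * W.tail s * freeWord F y - freeWord F x' * W.tail t * freeWord F y' ∈
    W.below (x ++ W.lead s ++ y)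

variable {W}

/-- Well-founded induction on the whole word. `nf` may have rewritten it by another rule or at
another place; confluence puts the difference of the two results in `below`, which `nf` kills by
induction. -/
theorem Confluent.nf_rel (hW : W.Confluent) (s : σ) (x y : List ι) :
    W.nf (freeWord F x * W.rel s * freeWord F y) = 0 := by
  suffices h : ∀ w s x y, w = x ++ W.lead s ++ y →
      W.nf (freeWord F x * W.rel s * freeWord F y) = 0 from h _ s x y rfl
  intro w
  induction w using W.wf.induction with
  | _ w ih =>
    intro s x y h
    have hb : W.below w ≤ LinearMap.ker W.nf := by
      rw [below, Submodule.span_le]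
      rintro _ ⟨s, x, y, h, rfl⟩
      exact ih _ h s x y rfl
    obtain ⟨t, x', y', h', e⟩ := W.nf_of_reducible (w := w) (fun H => H _ _ _ h)
    have := hb (h ▸ hW s t x y x' y' (h ▸ h'))
    rw [LinearMap.mem_ker, map_sub, sub_eq_zero] at this
    rw [rel, mul_sub, sub_mul, ← freeWord_append, ← freeWord_append, map_sub, ← h, e, this, sub_self]

/-- Confluence only has to be checked on overlaps and inclusions. -/
theorem confluent_of_overlaps
    (h₁ : ∀ s t a b c, b ≠ [] → W.lead s = a ++ b → W.lead t = b ++ c →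
      W.tail s * freeWord F c - freeWord F a * W.tail t ∈ W.below (a ++ b ++ c))
    (h₂ : ∀ s t a c, W.lead s = a ++ W.lead t ++ c →
      W.tail s - freeWord F a * W.tail t * freeWord F c ∈ W.below (W.lead s)) :
    W.Confluent := by
  -- By symmetry, `lead t` may be assumed to start no earlier than `lead s`.
  have key : ∀ s t x y a y', W.lead s ++ y = a ++ W.lead t ++ y' →
      freeWord F x * W.tail s * freeWord F y - freeWord F (x ++ a) * W.tail t * freeWord F y' ∈
        W.below (x ++ W.lead s ++ y) := by
    intro s t x y a y' h
    -- Disjoint occurrences always resolve: `tail s · z · lead t - lead s · z · tail t` equals `tail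
    -- s · z · rel t - rel s · z · tail t`, and both terms lie below.
    have disjoint : ∀ z, a = W.lead s ++ z → y = z ++ W.lead t ++ y' →
        freeWord F x * W.tail s * freeWord F y - freeWord F (x ++ a) * W.tail t * freeWord F y' ∈
          W.below (x ++ W.lead s ++ y) := by
      rintro z rfl rfl
      have e₁ : W.tail s * freeWord F z * W.rel t ∈ W.below (W.lead s ++ z ++ W.lead t) := by
        have h := W.tail_mem s
        generalize W.tail s = m at h ⊢
        induction h using Submodule.span_induction with
        | mem m h =>
          obtain ⟨v, hv, rfl⟩ := h
          have := mem_below (F := F) (W := W) (s := t) (x := v ++ z) (y := [])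
            (w := W.lead s ++ z ++ W.lead t)
            (by simpa using W.mul [] (z ++ W.lead t) hv)
          simpa [freeWord_append] using this
        | zero => simp
        | add a b _ _ ha hb => rw [add_mul, add_mul]; exact add_mem ha hb
        | smul c a _ ha => rw [smul_mul_assoc, smul_mul_assoc]; exact Submodule.smul_mem _ _ ha
      have e₂ : W.rel s * freeWord F z * W.tail t ∈ W.below (W.lead s ++ z ++ W.lead t) := by
        have h := W.tail_mem t
        generalize W.tail t = m at h ⊢
        induction h using Submodule.span_induction with
        | mem m h =>
          obtain ⟨v, hv, rfl⟩ := h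
          have := mem_below (F := F) (W := W) (s := s) (x := []) (y := z ++ v)
            (w := W.lead s ++ z ++ W.lead t)
            (by simpa using W.mul (W.lead s ++ z) [] hv)
          simpa [freeWord_append, mul_assoc] using this
        | zero => simp
        | add a b _ _ ha hb => rw [mul_add]; exact add_mem ha hb
        | smul c a _ ha => rw [mul_smul_comm]; exact Submodule.smul_mem _ _ ha
      have := below_mul (sub_mem e₁ e₂) x y'
      convert! this using 1
      · simp
      · simp only [rel, freeWord_append]
        noncomm_ring
    rw [List.append_assoc, List.append_eq_append_iff] at h
    obtain ⟨z, hz, hy⟩ | ⟨b, hs, hb⟩ := h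
    · exact disjoint z hz (by simpa using hy)
    by_cases hne : b = []
    · subst hne
      exact disjoint [] (by simpa using hs.symm) (by simpa using hb.symm)
    -- Now `lead t` starts inside `lead s`: it either ends there too (an inclusion) or reaches
    -- beyond (an overlap).
    rw [List.append_eq_append_iff] at hb
    obtain ⟨c, hc, hy⟩ | ⟨c, hc, hy⟩ := hb
    · have := below_mul (h₂ s t a c (by rw [hs, hc, List.append_assoc])) x y
      convert! this using 1
      rw [hy]
      simp only [freeWord_append]
      noncomm_ring
    · have := below_mul (h₁ s t a b c hne hs hc) x y'
      convert! this using 1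
      · rw [hy, hs]
        simp
      · rw [hy]
        simp only [freeWord_append]
        noncomm_ring
  intro s t x y x' y' h
  have h' := h
  rw [List.append_assoc, List.append_assoc, List.append_eq_append_iff] at h
  obtain ⟨a, rfl, ha⟩ | ⟨a, rfl, ha⟩ := h
  · exact key s t x y a y' (by simpa using ha)
  · have := key t s x' y' a y (by simpa using ha)
    rw [h', ← neg_sub]
    exact neg_mem this

end RewritingSystem

end DiamondLemma

/-! ### Jacobson's formula in characteristic `p`. -/

section Jacobson

/-- Pascal's rule, with `p` dividing `p.choose (k + 1)`, makes consecutive values opposite. -/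
theorem natCast_choose_prime_sub_one {R : Type*} [Ring R] {p : ℕ} (hp : p.Prime) (h0 : (p : R) = 0)
    {k : ℕ} (hk : k < p) : ((p - 1).choose k : R) = (-1) ^ k := by
  induction k with
  | zero => simp
  | succ k ih =>
    have h := Nat.choose_succ_succ' (p - 1) k
    rw [Nat.sub_add_cancel hp.one_le] at h
    obtain ⟨c, hc⟩ := hp.dvd_choose_self (Nat.succ_ne_zero k) hk
    have h' : (0 : R) = ((p - 1).choose k : R) + ((p - 1).choose (k + 1) : R) := by
      rw [← Nat.cast_add, ← h, hc, Nat.cast_mul, h0, zero_mul]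
    rw [ih (by omega)] at h'
    rw [pow_succ, mul_neg_one, eq_neg_iff_add_eq_zero, add_comm, ← h']

/-- The binomial sign and the sign of `y` multiply to `(-1)^(p-1)`, which is `1` in `R` even for `p
= 2`. -/
theorem Commute.sub_pow_prime_sub_one {R : Type*} [Ring R] {p : ℕ} (hp : p.Prime)
    (h0 : (p : R) = 0) {x y : R} (h : Commute x y) :
    (x - y) ^ (p - 1) = ∑ k ∈ Finset.range p, x ^ k * y ^ (p - 1 - k) := by
  rw [sub_eq_add_neg, (h.neg_right).add_pow, Nat.sub_add_cancel hp.one_le]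
  refine Finset.sum_congr rfl fun k hk => ?_
  have hk := Finset.mem_range.mp hk
  have h1 : ((-1 : R)) ^ (p - 1) = 1 := by
    have := natCast_choose_prime_sub_one hp h0 (k := p - 1) (by have := hp.pos; omega)
    simpa using this.symm
  rw [natCast_choose_prime_sub_one hp h0 hk, neg_pow y, mul_assoc,
    ((Commute.neg_one_left (y ^ (p - 1 - k))).pow_left (p - 1 - k)).eq, mul_assoc, ← pow_add,
    Nat.sub_add_cancel (by omega), h1, mul_one]

/-- The inner derivation `y ↦ x y - y x`. -/
noncomputable def innerDer (F : Type*) {A : Type*} [Field F] [Ring A] [Algebra F A] (x : A) :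
    A →ₗ[F] A :=
  LinearMap.mulLeft F x - LinearMap.mulRight F x

variable {F : Type*} [Field F] {p : ℕ} [Fact p.Prime] [CharP F p]

@[simp] theorem innerDer_apply {A : Type*} [Ring A] [Algebra F A] (x y : A) :
    innerDer F x y = x * y - y * x := rfl

theorem innerDer_pow_prime_sub_one {A : Type*} [Ring A] [Algebra F A] (x y : A) :
    (innerDer F x ^ (p - 1)) y = ∑ k ∈ Finset.range p, x ^ k * y * x ^ (p - 1 - k) := by
  have h0 : (p : Module.End F A) = 0 := by
    rw [← map_natCast (algebraMap F (Module.End F A)), CharP.cast_eq_zero, map_zero]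
  rw [innerDer, Commute.sub_pow_prime_sub_one Fact.out h0 (LinearMap.commute_mulLeft_right x x)]
  simp [LinearMap.pow_mulLeft, LinearMap.pow_mulRight, mul_assoc]

/-- The noncommutative Leibniz rule. For `n = p` the sum has the shape of
`innerDer_pow_prime_sub_one`, so differentiating a `p`-th power becomes an iterated commutator. -/
theorem Polynomial.derivative_pow_eq_sum {A : Type*} [Semiring A] (P : A[X]) (n : ℕ) :
    Polynomial.derivative (P ^ n) =
      ∑ k ∈ Finset.range n, P ^ k * Polynomial.derivative P * P ^ (n - 1 - k) := by
  induction n with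
  | zero => simp
  | succ n ih =>
    rw [pow_succ, Polynomial.derivative_mul, ih, Finset.sum_range_succ, Finset.sum_mul]
    congr 1
    · refine Finset.sum_congr rfl fun k hk => ?_
      have := Finset.mem_range.mp hk
      rw [mul_assoc, ← pow_succ]
      congr 2
      omega
    · simp

attribute [local instance 100] LieRing.ofAssociativeRing

variable {L : Type*} [LieRing L] [LieAlgebra F L] {A : Type*} [Ring A] [Algebra F A]

/-- The extension of a Lie algebra homomorphism `L → A` to polynomials. -/
noncomputable def polyExtend (f : L →ₗ⁅F⁆ A) : F[X] ⊗[F] L →ₗ[F] A[X] :=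
  TensorProduct.lift (LinearMap.mk₂ F
    (fun P x => P.map (algebraMap F A) * Polynomial.C (f x))
    (fun P Q x => by simp [add_mul])
    (fun c P x => by
      rw [Polynomial.smul_eq_C_mul, Polynomial.map_mul, Polynomial.map_C, mul_assoc,
        Polynomial.C_mul', algebraMap_smul])
    (fun P x y => by simp [mul_add])
    (fun c P x => by simp [← Polynomial.smul_C]))

theorem polyExtend_tmul (f : L →ₗ⁅F⁆ A) (P : F[X]) (x : L) :
    polyExtend f (P ⊗ₜ x) = P.map (algebraMap F A) * Polynomial.C (f x) := rfl

theorem Polynomial.commute_map_algebraMap (P : F[X]) (Q : A[X]) :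
    Commute (P.map (algebraMap F A)) Q := by
  induction P using Polynomial.induction_on' with
  | add P P' h h' => rw [Polynomial.map_add]; exact h.add_left h'
  | monomial n c =>
    rw [Polynomial.map_monomial, ← Polynomial.C_mul_X_pow_eq_monomial]
    refine Commute.mul_left ?_ (Polynomial.commute_X_pow Q n).symm.symm
    rw [commute_iff_eq]
    ext k
    simp [Algebra.commutes]

/-- Polynomials with coefficients in `F` are central in `A[X]`, so on pure tensors the bracket
becomes a commutator. -/
theorem polyExtend_lie (f : L →ₗ⁅F⁆ A) (u v : F[X] ⊗[F] L) :
    polyExtend f ⁅u, v⁆ = polyExtend f u * polyExtend f v - polyExtend f v * polyExtend f u := by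
  induction u using TensorProduct.induction_on with
  | zero =>
    have e : ⁅(0 : F[X] ⊗[F] L), v⁆ = 0 := zero_lie v
    simp [e]
  | add u u' h h' =>
    have e : ⁅u + u', v⁆ = ⁅u, v⁆ + ⁅u', v⁆ := add_lie u u' v
    rw [e, map_add, h, h', map_add]
    noncomm_ring
  | tmul P x =>
    induction v using TensorProduct.induction_on with
    | zero =>
      have e : ⁅P ⊗ₜ[F] x, (0 : F[X] ⊗[F] L)⁆ = 0 := lie_zero (P ⊗ₜ[F] x)
      simp [e]
    | add u u' h h' =>
      have e : ⁅P ⊗ₜ[F] x, u + u'⁆ = ⁅P ⊗ₜ[F] x, u⁆ + ⁅P ⊗ₜ[F] x, u'⁆ := lie_add (P ⊗ₜ[F] x) u u'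
      rw [e, map_add, h, h', map_add]
      noncomm_ring
    | tmul Q y =>
      rw [LieAlgebra.ExtendScalars.bracket_tmul]
      simp only [polyExtend_tmul, Polynomial.map_mul, LieHom.map_lie,
        LieRing.of_associative_ring_bracket, map_sub, Polynomial.C_mul]
      have h₁ := Polynomial.commute_map_algebraMap (A := A) Q (Polynomial.C (f x))
      have h₂ := Polynomial.commute_map_algebraMap (A := A) P (Polynomial.C (f y))
      have h₃ := Polynomial.commute_map_algebraMap (A := A) P (Q.map (algebraMap F A))
      rw [mul_assoc _ (Polynomial.C (f x)), ← mul_assoc (Polynomial.C (f x)), ← h₁.eq,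
        mul_assoc _ (Polynomial.C (f y)), ← mul_assoc (Polynomial.C (f y)), ← h₂.eq,
        mul_sub, ← mul_assoc, ← mul_assoc, ← mul_assoc, ← mul_assoc, ← mul_assoc, ← mul_assoc,
        h₃.eq]

theorem polyExtend_ad_pow (f : L →ₗ⁅F⁆ A) (u v : F[X] ⊗[F] L) (n : ℕ) :
    polyExtend f ((LieAlgebra.ad F[X] (F[X] ⊗[F] L) u ^ n) v) =
      (innerDer F (polyExtend f u) ^ n) (polyExtend f v) := by
  induction n with
  | zero => rfl
  | succ n ih =>
    rw [pow_succ', pow_succ', Module.End.mul_apply, Module.End.mul_apply, ← ih, innerDer_apply,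
      LieAlgebra.ad_apply, polyExtend_lie]

/-- Jacobson's formula. -/
theorem IsPMapping.map_add_pow {pm : L → L} (hpm : IsPMapping F p pm) (f : L →ₗ⁅F⁆ A) (a b : L) :
    (f a + f b) ^ p - f (pm (a + b)) = (f a ^ p - f (pm a)) + (f b ^ p - f (pm b)) := by
  have hp : p.Prime := Fact.out
  obtain ⟨s, hs, hadd⟩ := hpm.pm_add a b
  -- The derivative of `P ^ p` is the iterated commutator defining the `s i`, so the middle
  -- coefficients of `P ^ p` are the `f (s i)`; the outer ones are `f b ^ p` and `f a ^ p`. The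
  -- formula is the value at `1`.
  set P : A[X] := Polynomial.X * Polynomial.C (f a) + Polynomial.C (f b) with hP
  have hder : Polynomial.derivative (P ^ p) = ∑ i ∈ Finset.Icc 1 (p - 1),
      Polynomial.X ^ (i - 1) * Polynomial.C (f (i • s i)) := by
    have hP' : Polynomial.derivative P = Polynomial.C (f a) := by simp [hP]
    rw [Polynomial.derivative_pow_eq_sum, ← innerDer_pow_prime_sub_one (F := F), hP']
    have := congrArg (polyExtend f) hs
    rw [polyExtend_ad_pow, map_sum] at this
    simpa only [polyExtend_tmul, map_add, Polynomial.map_X, Polynomial.map_one, one_mul,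
      Polynomial.map_pow, hP] using this
  have hcoeff : ∀ i ∈ Finset.Icc 1 (p - 1), (P ^ p).coeff i = f (s i) := by
    intro i hi
    have hi' := Finset.mem_Icc.mp hi
    have h := congrArg (fun Q => Polynomial.coeff Q (i - 1)) hder
    simp only [Polynomial.coeff_derivative, Polynomial.finsetSum_coeff,
      Polynomial.coeff_X_pow_mul', Polynomial.coeff_C] at h
    rw [Finset.sum_eq_single i] at h
    · rw [if_pos le_rfl, if_pos (Nat.sub_self _), Nat.sub_add_cancel hi'.1, map_nsmul,
        ← Nat.cast_succ, Nat.succ_eq_add_one, Nat.sub_add_cancel hi'.1, ← nsmul_eq_mul',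
        ← Nat.cast_smul_eq_nsmul F, ← Nat.cast_smul_eq_nsmul F] at h
      -- The factor `i` from differentiation can be cancelled because `0 < i < p`.
      refine smul_right_injective A (r := (i : F)) ?_ h
      rw [Ne, CharP.cast_eq_zero_iff F p]
      intro hd
      have := Nat.le_of_dvd (by omega) hd
      have := hp.pos
      omega
    · intro j hj hne
      have hj' := Finset.mem_Icc.mp hj
      split_ifs with h₁ h₂
      · omega
      · rfl
      · rfl
    · intro h; exact absurd hi h
  have hdeg : P.natDegree ≤ 1 := by
    rw [hP]; compute_degree
  have hdeg' : (P ^ p).natDegree < p + 1 := by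
    have := Polynomial.natDegree_pow_le_of_le p hdeg
    omega
  have h0 : (P ^ p).coeff 0 = f b ^ p := by
    have : ∀ n, (P ^ n).coeff 0 = f b ^ n := by
      intro n
      induction n with
      | zero => simp
      | succ n ih => rw [pow_succ, Polynomial.mul_coeff_zero, ih, pow_succ]; simp [hP]
    exact this p
  have h1 : (P ^ p).coeff p = f a ^ p := by
    have := Polynomial.coeff_pow_of_natDegree_le (m := p) hdeg
    rw [mul_one] at this
    rw [this]
    simp [hP]
  have hev : (f a + f b) ^ p = (P ^ p).eval 1 := by
    -- Evaluation over a noncommutative ring is multiplicative at a central point such as `1`.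
    let E := Polynomial.eval₂RingHom' (RingHom.id A) 1 (fun a => Commute.one_right a)
    have h2 : E (P ^ p) = (P ^ p).eval 1 := rfl
    have h3 : E P = f a + f b := by
      change P.eval 1 = _
      simp [hP]
    rw [← h2, map_pow, h3]
  have hr : Finset.range (p + 1) = insert 0 (insert p (Finset.Icc 1 (p - 1))) := by
    ext k
    have := hp.pos
    simp only [Finset.mem_range, Finset.mem_insert, Finset.mem_Icc]
    omega
  rw [hev, Polynomial.eval_eq_sum_range' hdeg', hr, Finset.sum_insert, Finset.sum_insert]
  · simp only [one_pow, mul_one]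
    rw [Finset.sum_congr rfl hcoeff, h0, h1, hadd, map_add, map_add, map_sum]
    abel
  · have := hp.pos
    simp only [Finset.mem_Icc]; omega
  · have := hp.pos
    simp only [Finset.mem_insert, Finset.mem_Icc]; omega

/-- The `p`-character condition only has to be checked on a spanning set. -/
theorem IsPMapping.pow_sub_of_span {pm : L → L} (hpm : IsPMapping F p pm) (S : Module.Dual F L)
    (f : L →ₗ⁅F⁆ A) {s : Set L} (hs : Submodule.span F s = ⊤)
    (h : ∀ x ∈ s, f x ^ p - f (pm x) = algebraMap F A (S x ^ p)) (x : L) :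
    f x ^ p - f (pm x) = algebraMap F A (S x ^ p) := by
  have hsmul : ∀ (c : F) (x : L), f x ^ p - f (pm x) = algebraMap F A (S x ^ p) →
      f (c • x) ^ p - f (pm (c • x)) = algebraMap F A (S (c • x) ^ p) := by
    intro c x hx
    rw [map_smul, hpm.pm_smul, smul_pow, map_smul, ← smul_sub, hx, map_smul, smul_eq_mul, mul_pow,
      map_mul, Algebra.smul_def]
  have hx : x ∈ Submodule.span F s := hs ▸ Submodule.mem_top
  induction hx using Submodule.span_induction with
  | mem x hx => exact h x hx
  | zero =>
    have hp0 : p ≠ 0 := (Fact.out : p.Prime).ne_zero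
    have := hpm.pm_smul 0 0
    rw [zero_pow hp0, zero_smul, zero_smul] at this
    simp [this, hp0]
  -- The left side is additive by Jacobson's formula, the right side by Frobenius.
  | add a b _ _ ha hb =>
    rw [map_add f, hpm.map_add_pow, ha, hb, map_add, add_pow_char, map_add]
  | smul c x _ hx => exact hsmul c x hx

end Jacobson

/-! ### Compatibility of the shortlex order with concatenation. -/

section ShortlexAux

/-- Equal lengths exclude a proper prefix, the only case where appending on the right could break
lexicographic order. -/
theorem List.Shortlex.append_right_append {α : Type*} {r : α → α → Prop} {a b : List α}
    (h : List.Shortlex r a b) (y : List α) : List.Shortlex r (a ++ y) (b ++ y) := by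
  rw [List.shortlex_def] at *
  rcases h with h | ⟨h, h'⟩
  · left; simpa using h
  · refine Or.inr ⟨by simp [h], ?_⟩
    induction h' with
    | nil => simp at h
    | cons _ ih => exact List.Lex.cons (ih (by simpa using h))
    | rel h' => exact List.Lex.rel h'

theorem List.shortlex_of_lt_at {α : Type*} {r : α → α → Prop} (z : List α) {a b : α} (h : r a b)
    {x y : List α} (hl : x.length = y.length) :
    List.Shortlex r (z ++ a :: x) (z ++ b :: y) :=
  (List.Shortlex.of_lex (by simp [hl]) (List.Lex.rel h)).append_left z

end ShortlexAux

/-! ### The rewriting system of `u(L, S)` and its confluence. -/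

section ReducedRewriting

theorem IsPMapping.lie_pm_eq {F L : Type*} [Field F] [LieRing L] [LieAlgebra F L] {p : ℕ}
    [hp : Fact p.Prime] {pm : L → L} (hpm : IsPMapping F p pm) (a b : L) :
    ⁅pm a, b⁆ = (LieAlgebra.ad F L a ^ (p - 1)) ⁅a, b⁆ := by
  rw [← LieAlgebra.ad_apply F, hpm.ad_pm, ← LieAlgebra.ad_apply F L a b, ← Module.End.mul_apply,
    ← pow_succ, Nat.sub_add_cancel hp.out.one_le]

theorem IsPMapping.lie_pm_self {F L : Type*} [Field F] [LieRing L] [LieAlgebra F L] {p : ℕ}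
    [hp : Fact p.Prime] {pm : L → L} (hpm : IsPMapping F p pm) (a : L) : ⁅pm a, a⁆ = 0 := by
  rw [hpm.lie_pm_eq, lie_self, map_zero]

variable {F L ι : Type*} [Field F] [LieRing L] [LieAlgebra F L]

/-- The linear part of the free algebra on a basis of `L`. -/
noncomputable def linWord (e : Module.Basis ι F L) : L →ₗ[F] FreeAlgebra F ι :=
  e.constr F fun i => freeWord F [i]

@[simp] theorem linWord_basis (e : Module.Basis ι F L) (i : ι) :
    linWord e (e i) = freeWord F [i] := by
  rw [linWord, Module.Basis.constr_basis]

theorem linWord_mem [LinearOrder ι] (e : Module.Basis ι F L) (v : L) {w : List ι} (hw : 1 < w.length) :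
    linWord e v ∈ Submodule.span F (freeWord F '' {v | List.Shortlex (· < ·) v w}) := by
  have hv := e.mem_span v
  induction hv using Submodule.span_induction with
  | mem x h =>
    obtain ⟨i, rfl⟩ := h
    rw [linWord_basis]
    exact Submodule.subset_span ⟨_, List.Shortlex.of_length_lt (by simpa using hw), rfl⟩
  | zero => simp
  | add a b _ _ ha hb => rw [map_add]; exact add_mem ha hb
  | smul c a _ ha => rw [map_smul]; exact Submodule.smul_mem _ _ ha

/-- The rewriting system of `u(L, S)` in terms of an ordered basis of `L`: the rules
`e_j e_i → e_i e_j + [e_j, e_i]` for `i < j`, and `e_i ^ p → e_i^[p] + S(e_i)^p`. -/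
noncomputable def reducedSystem [LinearOrder ι] (e : Module.Basis ι F L) [WellFoundedLT ι] (p : ℕ)
    [hp : Fact p.Prime] (pm : L → L) (S : Module.Dual F L) :
    RewritingSystem F ι ({q : ι × ι // q.2 < q.1} ⊕ ι) where
  lt := List.Shortlex (· < ·)
  wf := List.Shortlex.wf wellFounded_lt
  mul x y h := (h.append_left x).append_right_append y
  lead := Sum.elim (fun q => [q.1.1, q.1.2]) (fun i => List.replicate p i)
  tail := Sum.elim (fun q => freeWord F [q.1.2, q.1.1] + linWord e ⁅e q.1.1, e q.1.2⁆)
    (fun i => linWord e (pm (e i)) + algebraMap F _ (S (e i) ^ p))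
  tail_mem := by
    rintro (⟨⟨j, i⟩, h⟩ | i)
    · refine add_mem (Submodule.subset_span ⟨_, ?_, rfl⟩) (linWord_mem e _ (by simp))
      exact List.shortlex_of_lt_at [] h rfl
    · have := hp.out.two_le
      refine add_mem (linWord_mem e _ (by simp; omega)) ?_
      rw [Algebra.algebraMap_eq_smul_one]
      refine Submodule.smul_mem _ _ (Submodule.subset_span ⟨[], ?_, rfl⟩)
      exact List.Shortlex.of_length_lt (by simp; omega)

variable [LinearOrder ι] (e : Module.Basis ι F L) [WellFoundedLT ι] {p : ℕ} [hp : Fact p.Prime] (pm : L → L)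
  (S : Module.Dual F L)

theorem reducedSystem_lead_inl (q : {q : ι × ι // q.2 < q.1}) :
    (reducedSystem e p pm S).lead (Sum.inl q) = [q.1.1, q.1.2] := rfl

theorem reducedSystem_lead_inr (i : ι) :
    (reducedSystem e p pm S).lead (Sum.inr i) = List.replicate p i := rfl

theorem reducedSystem_tail_inl (q : {q : ι × ι // q.2 < q.1}) :
    (reducedSystem e p pm S).tail (Sum.inl q) =
      freeWord F [q.1.2] * freeWord F [q.1.1] + linWord e ⁅e q.1.1, e q.1.2⁆ := by
  rw [← freeWord_append]; rfl

theorem reducedSystem_tail_inr (i : ι) :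
    (reducedSystem e p pm S).tail (Sum.inr i) =
      linWord e (pm (e i)) + algebraMap F _ (S (e i) ^ p) := rfl

theorem reducedSystem_swap_mem {j i : ι} (h : i < j) {x y w : List ι}
    (hw : List.Shortlex (· < ·) (x ++ [j, i] ++ y) w) :
    freeWord F x * (freeWord F [j] * freeWord F [i] - freeWord F [i] * freeWord F [j]
      - linWord e ⁅e j, e i⁆) * freeWord F y ∈ (reducedSystem e p pm S).below w := by
  have := RewritingSystem.mem_below (W := reducedSystem e p pm S) (s := Sum.inl ⟨(j, i), h⟩) hw
  rwa [RewritingSystem.rel, reducedSystem_tail_inl, reducedSystem_lead_inl,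
    freeWord_cons, ← sub_sub] at this

theorem reducedSystem_pow_mem (i : ι) {x y w : List ι}
    (hw : List.Shortlex (· < ·) (x ++ List.replicate p i ++ y) w) :
    freeWord F x * (freeWord F [i] ^ p - (linWord e (pm (e i)) + algebraMap F _ (S (e i) ^ p)))
      * freeWord F y ∈ (reducedSystem e p pm S).below w := by
  have := RewritingSystem.mem_below (W := reducedSystem e p pm S) (s := Sum.inr i) hw
  rwa [RewritingSystem.rel, reducedSystem_tail_inr, reducedSystem_lead_inr,
    freeWord_replicate] at this

/-- By bilinearity this reduces to basis letters, where it is a swap rule up to sign, or zero. The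
letters that occur are arbitrary, so only a bound on length can guarantee that the rules used are
below `w`. -/
theorem reducedSystem_lie_mem (u v : L) {x y w : List ι} (hw : x.length + 2 + y.length < w.length) :
    freeWord F x * (linWord e u * linWord e v - linWord e v * linWord e u - linWord e ⁅u, v⁆)
      * freeWord F y ∈ (reducedSystem e p pm S).below w := by
  have hu := e.mem_span u
  have hv := e.mem_span v
  induction hu using Submodule.span_induction with
  | mem u hu =>
    obtain ⟨j, rfl⟩ := hu
    induction hv using Submodule.span_induction with
    | mem v hv =>
      obtain ⟨i, rfl⟩ := hv
      rw [linWord_basis, linWord_basis]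
      rcases lt_trichotomy i j with h | rfl | h
      · exact reducedSystem_swap_mem e pm S h
          (List.Shortlex.of_length_lt (by simp; omega))
      · simp
      · have := reducedSystem_swap_mem e (p := p) pm S h (x := x) (y := y) (w := w)
          (List.Shortlex.of_length_lt (by simp; omega))
        rw [← lie_skew, map_neg]
        convert! neg_mem this using 1
        noncomm_ring
    | zero => simp
    | add a b _ _ ha hb =>
      convert! add_mem ha hb using 1
      simp only [lie_add, map_add]
      noncomm_ring
    | smul c a _ ha =>
      convert! Submodule.smul_mem _ c ha using 1
      simp only [lie_smul, map_smul, mul_smul_comm, smul_mul_assoc, ← smul_sub]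
  | zero => simp
  | add a b _ _ ha hb =>
    convert! add_mem ha hb using 1
    simp only [add_lie, map_add]
    noncomm_ring
  | smul c a _ ha =>
    convert! Submodule.smul_mem _ c ha using 1
    simp only [smul_lie, map_smul, mul_smul_comm, smul_mul_assoc, ← smul_sub]

/-- Each further commutator with `e_i` multiplies the previous relation by `e_i` on the left and on
the right, and adds one bracket relation. -/
theorem reducedSystem_innerDer_mem (i : ι) (v : L) (n : ℕ) {x y w : List ι}
    (hw : x.length + (n + 1) + y.length < w.length) :
    freeWord F x * ((innerDer F (freeWord F [i]) ^ n) (linWord e v)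
      - linWord e ((LieAlgebra.ad F L (e i) ^ n) v)) * freeWord F y
        ∈ (reducedSystem e p pm S).below w := by
  induction n generalizing x y with
  | zero => simp
  | succ n ih =>
    have h₁ := ih (x := x ++ [i]) (y := y) (by simp; omega)
    have h₂ := ih (x := x) (y := [i] ++ y) (by simp; omega)
    have h₃ := reducedSystem_lie_mem e (p := p) pm S (e i) ((LieAlgebra.ad F L (e i) ^ n) v)
      (x := x) (y := y) (w := w) (by omega)
    convert! add_mem (sub_mem h₁ h₂) h₃ using 1
    rw [pow_succ', Module.End.mul_apply, innerDer_apply, pow_succ' (LieAlgebra.ad F L (e i)),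
      Module.End.mul_apply, LieAlgebra.ad_apply, linWord_basis, freeWord_append, freeWord_append]
    noncomm_ring

variable {e} {pm}

/-- The sum is what the swaps leave behind when a letter passes through `e_i^p`; in characteristic
`p` it is `(ad e_i)^(p-1)`. -/
theorem sum_pow_lie_pow_mem [CharP F p] (i : ι) (v : L) {w : List ι} (hw : p < w.length) :
    (∑ k ∈ Finset.range p, freeWord F [i] ^ k * linWord e v * freeWord F [i] ^ (p - 1 - k))
      - linWord e ((LieAlgebra.ad F L (e i) ^ (p - 1)) v) ∈ (reducedSystem e p pm S).below w := by
  have := reducedSystem_innerDer_mem e (p := p) pm S i v (p - 1) (x := []) (y := []) (w := w)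
    (by have := hp.out.pos; simp; omega)
  rw [innerDer_pow_prime_sub_one] at this
  simpa using this

/-- Sorting along `jki, jik` and along `kij, ikj` leads to `ijk` through words below `kji`. The
remaining brackets cancel by the Jacobi identity. -/
theorem reducedSystem_overlap_swap_swap {i j k : ι} (hij : i < j) (hjk : j < k) :
    (freeWord F [j] * freeWord F [k] + linWord e ⁅e k, e j⁆) * freeWord F [i]
      - freeWord F [k] * (freeWord F [i] * freeWord F [j] + linWord e ⁅e j, e i⁆)
      ∈ (reducedSystem e p pm S).below [k, j, i] := by
  have hik := hij.trans hjk
  have h₁ := reducedSystem_swap_mem e (p := p) pm S hik (x := [j]) (y := []) (w := [k, j, i])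
    (List.shortlex_of_lt_at [] hjk rfl)
  have h₂ := reducedSystem_swap_mem e (p := p) pm S hij (x := []) (y := [k]) (w := [k, j, i])
    (List.shortlex_of_lt_at [] hjk rfl)
  have h₃ := reducedSystem_swap_mem e (p := p) pm S hik (x := []) (y := [j]) (w := [k, j, i])
    (List.shortlex_of_lt_at [k] hij rfl)
  have h₄ := reducedSystem_swap_mem e (p := p) pm S hjk (x := [i]) (y := []) (w := [k, j, i])
    (List.shortlex_of_lt_at [] hik rfl)
  have l₁ := reducedSystem_lie_mem e (p := p) pm S ⁅e k, e j⁆ (e i) (x := []) (y := [])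
    (w := [k, j, i]) (by simp)
  have l₂ := reducedSystem_lie_mem e (p := p) pm S ⁅e j, e i⁆ (e k) (x := []) (y := [])
    (w := [k, j, i]) (by simp)
  have l₃ := reducedSystem_lie_mem e (p := p) pm S ⁅e k, e i⁆ (e j) (x := []) (y := [])
    (w := [k, j, i]) (by simp)
  have jac : linWord e ⁅⁅e k, e j⁆, e i⁆ + linWord e ⁅⁅e j, e i⁆, e k⁆
      - linWord e ⁅⁅e k, e i⁆, e j⁆ = 0 := by
    rw [← map_add, ← map_sub]
    convert! map_zero (linWord e)
    rw [lie_lie (e k) (e j) (e i), ← lie_skew (e k) ⁅e j, e i⁆, ← lie_skew (e j) ⁅e k, e i⁆]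
    abel
  have := add_mem (sub_mem (sub_mem (add_mem h₁ h₂) h₃) h₄) (sub_mem (add_mem l₁ l₂) l₃)
  convert! this using 1
  simp only [freeWord_nil, one_mul, mul_one, linWord_basis]
  rw [← sub_eq_zero, ← jac]
  noncomm_ring

/-- Moving `e_j` through `e_i^p` letter by letter telescopes. What is left is `(ad e_i)^(p-1) [e_j,
e_i] = -[e_i^[p], e_j]`, the bracket produced by applying the power rule first. -/
theorem reducedSystem_overlap_swap_pow [CharP F p] (hpm : IsPMapping F p pm)
    {i j : ι} (hij : i < j) :
    (freeWord F [i] * freeWord F [j] + linWord e ⁅e j, e i⁆) * freeWord F [i] ^ (p - 1)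
      - freeWord F [j] * (linWord e (pm (e i)) + algebraMap F _ (S (e i) ^ p))
      ∈ (reducedSystem e p pm S).below (j :: List.replicate p i) := by
  have hp1 := hp.out.two_le
  set X := freeWord F [i] with hX
  set Y := freeWord F [j] with hY
  set l := linWord e ⁅e j, e i⁆ with hl
  -- Exponents start at `k + 1`: the swap with nothing in front has the ambiguous word itself as
  -- leading word, so it is not below it.
  have h₁ : ∑ k ∈ Finset.range (p - 1), X ^ (k + 1) * (Y * X - X * Y - l) * X ^ (p - 1 - (k + 1))
      ∈ (reducedSystem e p pm S).below (j :: List.replicate p i) := by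
    refine sum_mem fun k hk => ?_
    have hk := Finset.mem_range.mp hk
    have := reducedSystem_swap_mem e (p := p) pm S hij (x := List.replicate (k + 1) i)
      (y := List.replicate (p - 1 - (k + 1)) i) (w := j :: List.replicate p i)
      (by
        rw [List.replicate_succ]
        exact List.shortlex_of_lt_at [] hij (by simp; omega))
    rwa [freeWord_replicate, freeWord_replicate] at this
  have h₂ := reducedSystem_pow_mem e (p := p) pm S i (x := []) (y := [j])
    (w := j :: List.replicate p i) (by
      obtain ⟨n, rfl⟩ := Nat.exists_eq_succ_of_ne_zero hp.out.ne_zero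
      rw [List.replicate_succ]
      exact List.shortlex_of_lt_at [] hij (by simp))
  have h₃ := sum_pow_lie_pow_mem (e := e) (pm := pm) S i ⁅e j, e i⁆
    (w := j :: List.replicate p i) (by simp)
  have h₄ := reducedSystem_lie_mem e (p := p) pm S (pm (e i)) (e j) (x := []) (y := [])
    (w := j :: List.replicate p i) (by simp; omega)
  convert! add_mem (add_mem (add_mem h₁ h₂) h₃) h₄ using 1
  have tel : ∑ k ∈ Finset.range p, X ^ k * (Y * X - X * Y) * X ^ (p - 1 - k)
      = Y * X ^ p - X ^ p * Y := by
    have := Finset.sum_range_sub' (fun k => X ^ k * Y * X ^ (p - k)) p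
    simp only [pow_zero, one_mul, Nat.sub_zero, Nat.sub_self, mul_one] at this
    rw [← this]
    refine Finset.sum_congr rfl fun k hk => ?_
    have hk := Finset.mem_range.mp hk
    rw [show p - k = (p - 1 - k) + 1 by omega, show p - (k + 1) = p - 1 - k by omega, pow_succ',
      pow_succ]
    noncomm_ring
  have e₁ : ∑ k ∈ Finset.range (p - 1), X ^ (k + 1) * (Y * X - X * Y - l) * X ^ (p - 1 - (k + 1))
      = (Y * X ^ p - X ^ p * Y) - ∑ k ∈ Finset.range p, X ^ k * l * X ^ (p - 1 - k)
        - (Y * X - X * Y - l) * X ^ (p - 1) := by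
    rw [← tel, ← Finset.sum_sub_distrib]
    have := Finset.sum_range_succ' (fun k => X ^ k * (Y * X - X * Y - l) * X ^ (p - 1 - k)) (p - 1)
    rw [Nat.sub_add_cancel hp.out.one_le] at this
    simp only [pow_zero, one_mul, Nat.sub_zero] at this
    rw [eq_sub_iff_add_eq, ← this]
    refine Finset.sum_congr rfl fun k hk => ?_
    noncomm_ring
  have e₂ : (LieAlgebra.ad F L (e i) ^ (p - 1)) ⁅e j, e i⁆ = - ⁅pm (e i), e j⁆ := by
    rw [hpm.lie_pm_eq, ← lie_skew, map_neg]
  have e₃ : X ^ p = X * X ^ (p - 1) := by rw [← pow_succ', Nat.sub_add_cancel hp.out.one_le]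
  rw [e₁, e₂, map_neg, e₃]
  simp only [freeWord_nil, one_mul, mul_one, linWord_basis, ← hX, ← hY]
  rw [mul_add Y, ← Algebra.commutes]
  noncomm_ring

/-- The mirror image: `e_i` moves left through `e_j^p`, and now the swap with `p - 1` letters in
front is the one that is not below the word. -/
theorem reducedSystem_overlap_pow_swap [CharP F p] (hpm : IsPMapping F p pm)
    {i j : ι} (hij : i < j) :
    (linWord e (pm (e j)) + algebraMap F _ (S (e j) ^ p)) * freeWord F [i]
      - freeWord F [j] ^ (p - 1) * (freeWord F [i] * freeWord F [j] + linWord e ⁅e j, e i⁆)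
      ∈ (reducedSystem e p pm S).below (List.replicate p j ++ [i]) := by
  have hp1 := hp.out.two_le
  set X := freeWord F [j] with hX
  set Y := freeWord F [i] with hY
  set l := linWord e ⁅e j, e i⁆ with hl
  have h₁ : ∑ k ∈ Finset.range (p - 1), X ^ k * (X * Y - Y * X - l) * X ^ (p - 1 - k)
      ∈ (reducedSystem e p pm S).below (List.replicate p j ++ [i]) := by
    refine sum_mem fun k hk => ?_
    have hk := Finset.mem_range.mp hk
    have := reducedSystem_swap_mem e (p := p) pm S hij (x := List.replicate k j)
      (y := List.replicate (p - 1 - k) j) (w := List.replicate p j ++ [i])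
      (by
        rw [show p = (k + 1) + ((p - 1 - (k + 1)) + 1) by omega, List.replicate_add,
          List.replicate_succ (n := p - 1 - (k + 1))]
        have := List.shortlex_of_lt_at (List.replicate (k + 1) j) hij
          (x := List.replicate (p - 1 - k) j) (y := List.replicate (p - 1 - (k + 1)) j ++ [i])
          (by simp; omega)
        convert! this using 1
        · simp [List.replicate_succ']
          congr 1
          omega
        · simp)
    rwa [freeWord_replicate, freeWord_replicate] at this
  have h₂ := reducedSystem_pow_mem e (p := p) pm S j (x := [i]) (y := [])
    (w := List.replicate p j ++ [i]) (by
      obtain ⟨n, rfl⟩ := Nat.exists_eq_succ_of_ne_zero hp.out.ne_zero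
      nth_rw 2 [List.replicate_succ]
      exact List.shortlex_of_lt_at [] hij (by simp))
  have h₃ := sum_pow_lie_pow_mem (e := e) (pm := pm) S j ⁅e j, e i⁆
    (w := List.replicate p j ++ [i]) (by simp)
  have h₄ := reducedSystem_lie_mem e (p := p) pm S (pm (e j)) (e i) (x := []) (y := [])
    (w := List.replicate p j ++ [i]) (by simp; omega)
  convert! sub_mem h₄ (add_mem (add_mem h₁ h₂) h₃) using 1
  have tel : ∑ k ∈ Finset.range p, X ^ k * (X * Y - Y * X) * X ^ (p - 1 - k)
      = X ^ p * Y - Y * X ^ p := by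
    have := Finset.sum_range_sub (fun k => X ^ k * Y * X ^ (p - k)) p
    simp only [pow_zero, one_mul, Nat.sub_zero, Nat.sub_self, mul_one] at this
    rw [← this]
    refine Finset.sum_congr rfl fun k hk => ?_
    have hk := Finset.mem_range.mp hk
    rw [show p - k = (p - 1 - k) + 1 by omega, show p - (k + 1) = p - 1 - k by omega,
      pow_succ X k, pow_succ' X (p - 1 - k)]
    noncomm_ring
  have e₁ : ∑ k ∈ Finset.range (p - 1), X ^ k * (X * Y - Y * X - l) * X ^ (p - 1 - k)
      = (X ^ p * Y - Y * X ^ p) - ∑ k ∈ Finset.range p, X ^ k * l * X ^ (p - 1 - k)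
        - X ^ (p - 1) * (X * Y - Y * X - l) := by
    rw [← tel, ← Finset.sum_sub_distrib]
    have := Finset.sum_range_succ (fun k => X ^ k * (X * Y - Y * X - l) * X ^ (p - 1 - k)) (p - 1)
    rw [Nat.sub_add_cancel hp.out.one_le] at this
    simp only [Nat.sub_self, pow_zero, mul_one] at this
    rw [eq_sub_iff_add_eq, ← this]
    refine Finset.sum_congr rfl fun k hk => ?_
    noncomm_ring
  have e₃ : X ^ p = X ^ (p - 1) * X := by rw [← pow_succ, Nat.sub_add_cancel hp.out.one_le]
  rw [e₁, ← hpm.lie_pm_eq, e₃]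
  simp only [freeWord_nil, one_mul, mul_one, linWord_basis, ← hX, ← hY]
  rw [add_mul _ _ Y, Algebra.commutes (S (e j) ^ p) Y]
  noncomm_ring

/-- The difference is the commutator of `e_i^[p]` with `e_i^r`, which telescopes into relations for
`[e_i^[p], e_i] = 0`. -/
theorem reducedSystem_overlap_pow_pow (hpm : IsPMapping F p pm) (i : ι) (r : ℕ) :
    (linWord e (pm (e i)) + algebraMap F _ (S (e i) ^ p)) * freeWord F [i] ^ r
      - freeWord F [i] ^ r * (linWord e (pm (e i)) + algebraMap F _ (S (e i) ^ p))
      ∈ (reducedSystem e p pm S).below (List.replicate (p + r) i) := by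
  have hp1 := hp.out.two_le
  set X := freeWord F [i] with hX
  set Y := linWord e (pm (e i)) with hY
  have h₁ : ∑ k ∈ Finset.range r, X ^ k * (Y * X - X * Y) * X ^ (r - 1 - k)
      ∈ (reducedSystem e p pm S).below (List.replicate (p + r) i) := by
    refine sum_mem fun k hk => ?_
    have hk := Finset.mem_range.mp hk
    have := reducedSystem_lie_mem e (p := p) pm S (pm (e i)) (e i) (x := List.replicate k i)
      (y := List.replicate (r - 1 - k) i) (w := List.replicate (p + r) i) (by simp; omega)
    rwa [freeWord_replicate, freeWord_replicate, hpm.lie_pm_self, map_zero, sub_zero,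
      linWord_basis] at this
  convert! h₁ using 1
  have tel : ∑ k ∈ Finset.range r, X ^ k * (Y * X - X * Y) * X ^ (r - 1 - k)
      = Y * X ^ r - X ^ r * Y := by
    have := Finset.sum_range_sub' (fun k => X ^ k * Y * X ^ (r - k)) r
    simp only [pow_zero, one_mul, Nat.sub_zero, Nat.sub_self, mul_one] at this
    rw [← this]
    refine Finset.sum_congr rfl fun k hk => ?_
    have hk := Finset.mem_range.mp hk
    rw [show r - k = (r - 1 - k) + 1 by omega, show r - (k + 1) = r - 1 - k by omega, pow_succ',
      pow_succ]
    noncomm_ring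
  rw [tel, add_mul, mul_add, Algebra.commutes]
  abel

theorem reducedSystem_confluent [CharP F p] (hpm : IsPMapping F p pm) :
    (reducedSystem e p pm S).Confluent := by
  have hp1 := hp.out.two_le
  apply RewritingSystem.confluent_of_overlaps
  · rintro (⟨⟨k, j⟩, hjk⟩ | m) (⟨⟨j', i⟩, hij⟩ | n) a b c hb hs ht
    · simp only at hjk hij
      rw [reducedSystem_lead_inl] at hs ht
      simp only at hs ht
      rw [reducedSystem_tail_inl, reducedSystem_tail_inl]
      simp only
      -- Since `b` is nonempty, `a` has at most one letter; if it is empty, the two rules coincide.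
      rcases a with _ | ⟨a₁, _ | ⟨a₂, a⟩⟩
      · subst hs
        simp only [List.cons_append, List.nil_append, List.cons.injEq] at ht
        obtain ⟨rfl, rfl, rfl⟩ := ht
        simp
      · simp only [List.cons_append, List.nil_append, List.cons.injEq] at hs
        obtain ⟨rfl, rfl⟩ := hs
        simp only [List.cons_append, List.nil_append, List.cons.injEq] at ht
        obtain ⟨rfl, rfl⟩ := ht
        exact reducedSystem_overlap_swap_swap S hij hjk
      · simp at hs
        exact absurd hs.2.2.2 hb
    · simp only at hjk
      rw [reducedSystem_lead_inl] at hs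
      rw [reducedSystem_lead_inr] at ht
      simp only at hs
      have ht' := List.append_eq_replicate_iff.mp ht.symm
      rw [reducedSystem_tail_inl, reducedSystem_tail_inr]
      simp only
      rcases a with _ | ⟨a₁, _ | ⟨a₂, a⟩⟩
      · subst hs
        simp [List.replicate_succ] at ht'
        exact absurd (ht'.2.1.2.trans ht'.2.1.1.symm) hjk.ne
      · simp only [List.cons_append, List.nil_append, List.cons.injEq] at hs
        obtain ⟨rfl, rfl⟩ := hs
        simp [List.replicate_succ] at ht'
        obtain ⟨hl, rfl, hc⟩ := ht'
        have hc' : c = List.replicate (p - 1) j := by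
          rw [hc]; congr 1; omega
        have := reducedSystem_overlap_swap_pow (e := e) S hpm hjk
        rw [hc', freeWord_replicate]
        convert! this using 2
        rw [← hc', ht]
        rfl
      · simp at hs
        exact absurd hs.2.2.2 hb
    · simp only at hij
      rw [reducedSystem_lead_inr] at hs
      rw [reducedSystem_lead_inl] at ht
      simp only at ht
      have hs' := List.append_eq_replicate_iff.mp hs.symm
      rw [reducedSystem_tail_inl, reducedSystem_tail_inr]
      simp only
      rcases b with _ | ⟨b₁, _ | ⟨b₂, b⟩⟩
      · exact absurd rfl hb
      · simp only [List.cons_append, List.nil_append, List.cons.injEq] at ht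
        obtain ⟨rfl, rfl⟩ := ht
        simp [List.replicate_succ] at hs'
        obtain ⟨hl, ha, rfl⟩ := hs'
        have ha' : a = List.replicate (p - 1) j' := by
          rw [ha]; congr 1; omega
        have := reducedSystem_overlap_pow_swap (e := e) S hpm hij
        rw [← hs, ha', freeWord_replicate]
        exact this
      · simp only [List.cons_append, List.cons.injEq] at ht
        obtain ⟨rfl, rfl, -⟩ := ht
        simp [List.replicate_succ] at hs'
        exact absurd (hs'.2.2.2.1.trans hs'.2.2.1.symm) hij.ne
    · rw [reducedSystem_lead_inr] at hs ht
      have hs' := List.append_eq_replicate_iff.mp hs.symm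
      have ht' := List.append_eq_replicate_iff.mp ht.symm
      have hmn : m = n := by
        rcases b with _ | ⟨b₁, b⟩
        · exact absurd rfl hb
        · simp [List.replicate_succ] at hs' ht'
          exact hs'.2.2.1.symm.trans ht'.2.1.1
      -- The overlap is nonempty, so both rules concern the same letter and the word is `m^(p+r)`
      -- with `r` the length of `a`.
      subst hmn
      rw [← hs, reducedSystem_tail_inr, hs'.2.1, ht'.2.2]
      have hl : c.length = a.length := by omega
      rw [hl, freeWord_replicate, ← List.replicate_add]
      exact reducedSystem_overlap_pow_pow S hpm m a.length
  · rintro s t a c h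
    have hst : s = t → (reducedSystem e p pm S).tail s - freeWord F a *
        (reducedSystem e p pm S).tail t * freeWord F c ∈
          (reducedSystem e p pm S).below ((reducedSystem e p pm S).lead s) := by
      rintro rfl
      have hl := congrArg List.length h
      simp only [List.length_append] at hl
      have ha : a = [] := List.length_eq_zero_iff.mp (by omega)
      have hc : c = [] := List.length_eq_zero_iff.mp (by omega)
      simp [ha, hc]
    apply hst
    clear hst
    have hl := congrArg List.length h
    rcases s with ⟨⟨k, j⟩, hjk⟩ | m <;> rcases t with ⟨⟨j', i⟩, hij⟩ | n
    · rw [reducedSystem_lead_inl, reducedSystem_lead_inl] at h hl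
      simp at hl
      obtain ⟨ha, hc⟩ : a.length = 0 ∧ c.length = 0 := by omega
      rw [List.length_eq_zero_iff] at ha hc
      subst ha hc
      simp at h
      simp [h]
    · rw [reducedSystem_lead_inl, reducedSystem_lead_inr] at h hl
      simp at hl
      -- A power can only sit inside a two-letter word if `p = 2`, and then the two distinct letters
      -- would be equal.
      obtain ⟨ha, hc, hp2⟩ : a.length = 0 ∧ c.length = 0 ∧ p = 2 := by omega
      rw [List.length_eq_zero_iff] at ha hc
      subst ha hc
      rw [hp2] at h
      simp [List.replicate_succ] at h
      exact absurd (h.2.trans h.1.symm) (by simpa using hjk.ne)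
    · rw [reducedSystem_lead_inl, reducedSystem_lead_inr] at h
      have hj : j' ∈ List.replicate p m := by rw [h]; simp
      have hi : i ∈ List.replicate p m := by rw [h]; simp
      rw [List.mem_replicate] at hj hi
      exact absurd (hi.2.trans hj.2.symm) (by simpa using hij.ne)
    · rw [reducedSystem_lead_inr, reducedSystem_lead_inr] at h
      have hm : n ∈ List.replicate p m := by rw [h]; simp [hp.out.ne_zero]
      rw [(List.mem_replicate.mp hm).2]

end ReducedRewriting

/-! ### Combinatorics of restricted words. -/

section RestrictedWords

/-- A nondecreasing word in which every letter occurs fewer than `p` times. -/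
def IsRestrictedWord {ι : Type*} [LinearOrder ι] (p : ℕ) (w : List ι) : Prop :=
  w.Pairwise (· ≤ ·) ∧ ∀ i, w.count i < p

/-- The bound on `x` is there for the induction: it forces `x` to be empty when the first letter is
`i`. -/
theorem List.Pairwise.exists_append_replicate_count {ι : Type*} [LinearOrder ι] {l : List ι}
    (hl : l.Pairwise (· ≤ ·)) (i : ι) :
    ∃ x y, (∀ a ∈ x, a < i) ∧ l = x ++ List.replicate (l.count i) i ++ y := by
  induction l with
  | nil => exact ⟨[], [], by simp, rfl⟩
  | cons a l ih =>
    rw [List.pairwise_cons] at hl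
    rcases lt_trichotomy a i with h | rfl | h
    · obtain ⟨x, y, hx, e⟩ := ih hl.2
      refine ⟨a :: x, y, by simpa [h] using hx, ?_⟩
      rw [List.count_cons_of_ne h.ne, List.cons_append, List.cons_append, ← e]
    · obtain ⟨x, y, hx, e⟩ := ih hl.2
      have hx0 : x = [] := List.eq_nil_iff_forall_not_mem.mpr fun b hb =>
        (hx b hb).not_ge (hl.1 b (by rw [e]; simp [hb]))
      refine ⟨[], y, by simp, ?_⟩
      rw [List.count_cons_self, List.replicate_succ]
      simpa [hx0] using e
    · refine ⟨[], a :: l, by simp, ?_⟩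
      rw [List.count_eq_zero_of_not_mem]
      · simp
      · rw [List.mem_cons, not_or]
        exact ⟨h.ne, fun hi => (hl.1 i hi).not_gt h⟩

/-- Counts determine a word up to permutation, hence a sorted word; sorting a multiset realizes any
counts. -/
theorem isRestrictedWord_count_bijective {ι : Type*} [LinearOrder ι] [Fintype ι] (p : ℕ) :
    Function.Bijective (fun (w : {w : List ι // IsRestrictedWord p w}) (i : ι) =>
      (⟨w.1.count i, w.2.2 i⟩ : Fin p)) := by
  constructor
  · rintro ⟨v, hv⟩ ⟨w, hw⟩ h
    have hc : ∀ i, v.count i = w.count i := fun i => congrArg Fin.val (congrFun h i)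
    exact Subtype.ext ((List.perm_iff_count.mpr hc).eq_of_pairwise
      (fun _ _ _ _ h h' => le_antisymm h h') hv.1 hw.1)
  · intro a
    have hc : ∀ i, ((∑ j, Multiset.replicate (a j : ℕ) j).sort (· ≤ ·)).count i = a i := by
      intro i
      rw [← Multiset.coe_count, Multiset.sort_eq, Multiset.count_sum']
      simp [Multiset.count_replicate]
    refine ⟨⟨(∑ j, Multiset.replicate (a j : ℕ) j).sort (· ≤ ·),
      Multiset.pairwise_sort _ _, fun i => (hc i).trans_lt (a i).2⟩, ?_⟩
    funext i
    exact Fin.ext (hc i)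

instance {ι : Type*} [LinearOrder ι] [Finite ι] (p : ℕ) :
    Finite {w : List ι // IsRestrictedWord p w} := by
  have := Fintype.ofFinite ι
  exact Finite.of_injective _ (isRestrictedWord_count_bijective p).1

theorem card_isRestrictedWord {ι : Type*} [LinearOrder ι] [Finite ι] (p : ℕ) :
    Nat.card {w : List ι // IsRestrictedWord p w} = p ^ Nat.card ι := by
  have := Fintype.ofFinite ι
  rw [Nat.card_congr (Equiv.ofBijective _ (isRestrictedWord_count_bijective p))]
  simp

theorem IsRestrictedWord.lt_of_replicate_sublist {ι : Type*} [LinearOrder ι] {p n : ℕ}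
    {w : List ι} (hw : IsRestrictedWord p w) {i : ι} (h : (List.replicate n i).Sublist w) : n < p :=
  (List.replicate_sublist_iff.mp h).trans_lt (hw.2 i)

/-- A restricted word in an ordered sum splits. -/
theorem IsRestrictedWord.exists_append {κ μ : Type*} [LinearOrder κ] [LinearOrder μ] {p : ℕ}
    {w : List (κ ⊕ₗ μ)} (hw : IsRestrictedWord p w) :
    ∃ (v : List κ) (u : List μ), IsRestrictedWord p v ∧
      w = v.map (fun i => toLex (Sum.inl i)) ++ u.map (fun i => toLex (Sum.inr i)) := by
  have split : ∀ w : List (κ ⊕ₗ μ), w.Pairwise (· ≤ ·) → ∃ (v : List κ) (u : List μ),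
      w = v.map (fun i => toLex (Sum.inl i)) ++ u.map (fun i => toLex (Sum.inr i)) := by
    intro w hw
    induction w with
    | nil => exact ⟨[], [], rfl⟩
    | cons a w ih =>
      rw [List.pairwise_cons] at hw
      obtain ⟨v, u, e⟩ := ih hw.2
      rcases h : ofLex a with i | j
      · exact ⟨i :: v, u, by simp [e, ← h]⟩
      · cases v with
        | nil => exact ⟨[], j :: u, by simp [e, ← h]⟩
        | cons c v =>
          have hc := hw.1 (toLex (Sum.inl c)) (by simp [e])
          rw [← toLex_ofLex a, h] at hc
          exact absurd hc Sum.Lex.not_inr_le_inl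
  obtain ⟨v, u, rfl⟩ := split w hw.1
  refine ⟨v, u, ⟨?_, fun i => ?_⟩, rfl⟩
  · have := (List.pairwise_append.mp hw.1).1
    rw [List.pairwise_map] at this
    simpa using this
  · have h := (List.replicate_sublist_iff.mpr (le_refl (v.count i))).map
      (fun i => (toLex (Sum.inl i) : κ ⊕ₗ μ))
    rw [List.map_replicate] at h
    exact hw.lt_of_replicate_sublist (h.trans (List.sublist_append_left _ _))

end RestrictedWords

/-! ### The PBW theorem: spanning by rewriting, independence by confluence. -/

section ReducedPBW

attribute [local instance 100] LieRing.ofAssociativeRing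

section Evaluation

variable {F L ι A : Type*} [Field F] [LieRing L] [LieAlgebra F L] [Ring A] [Algebra F A]
  (e : Module.Basis ι F L) (f : L →ₗ⁅F⁆ A)

theorem lift_linWord (v : L) :
    FreeAlgebra.lift F (fun i => f (e i)) (linWord e v) = f v := by
  have : (FreeAlgebra.lift F (fun i => f (e i))).toLinearMap ∘ₗ linWord e = (f : L →ₗ[F] A) := by
    apply e.ext
    intro i
    simp [freeWord]
  exact LinearMap.congr_fun this v

theorem lift_freeWord (w : List ι) :
    FreeAlgebra.lift F (fun i => f (e i)) (freeWord F w) = (w.map fun i => f (e i)).prod := by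
  rw [freeWord, map_list_prod, List.map_map]
  congr 1
  simp

end Evaluation

variable {F L ι : Type*} [Field F] [LieRing L] [LieAlgebra F L] [LinearOrder ι] [WellFoundedLT ι]
  {p : ℕ} [hp : Fact p.Prime]

/-- A word with no adjacent descent is sorted, so equal letters form one block, and a count of at
least `p` gives a factor `i^p`. -/
theorem reducedSystem_irreducible_iff (e : Module.Basis ι F L) (pm : L → L)
    (S : Module.Dual F L) {w : List ι} :
    (reducedSystem e p pm S).Irreducible w ↔ IsRestrictedWord p w := by
  constructor
  · intro h
    have hs : w.Pairwise (· ≤ ·) := by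
      rw [← List.isChain_iff_pairwise, List.isChain_iff_forall_rel_of_append_cons_cons]
      rintro a b l₁ l₂ rfl
      by_contra hab
      exact h (Sum.inl ⟨(a, b), not_le.mp hab⟩) l₁ l₂ (by simp [reducedSystem_lead_inl])
    refine ⟨hs, fun i => ?_⟩
    by_contra hi
    obtain ⟨x, y, -, e'⟩ := hs.exists_append_replicate_count i
    refine h (Sum.inr i) x (List.replicate (w.count i - p) i ++ y) ?_
    rw [reducedSystem_lead_inr, List.append_assoc, ← List.append_assoc (List.replicate p i),
      ← List.replicate_add, Nat.add_sub_cancel' (not_lt.mp hi), ← List.append_assoc, ← e']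
  · rintro ⟨hs, hc⟩ (⟨⟨j, i⟩, hij⟩ | i) x y rfl
    · rw [reducedSystem_lead_inl, List.append_assoc, List.pairwise_append] at hs
      have := hs.2.1
      simp only [List.cons_append, List.pairwise_cons, List.mem_cons] at this
      exact (this.1 i (Or.inl rfl)).not_gt hij
    · have := hc i
      rw [reducedSystem_lead_inr, List.count_append, List.count_append,
        List.count_replicate_self] at this
      omega

section Evaluation

variable {A : Type*} [Ring A] [Algebra F A] {pm : L → L} {S : Module.Dual F L}
  (e : Module.Basis ι F L) (f : L →ₗ⁅F⁆ A)

theorem lift_reducedSystem_rel (hf : ∀ x, f x ^ p - f (pm x) = algebraMap F A (S x ^ p))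
    (s : {q : ι × ι // q.2 < q.1} ⊕ ι) :
    FreeAlgebra.lift F (fun i => f (e i)) ((reducedSystem e p pm S).rel s) = 0 := by
  rw [RewritingSystem.rel, map_sub, lift_freeWord]
  rcases s with q | i
  · rw [reducedSystem_lead_inl, reducedSystem_tail_inl, map_add, map_mul, lift_freeWord,
      lift_freeWord, lift_linWord, LieHom.map_lie, LieRing.of_associative_ring_bracket]
    simp
  · rw [reducedSystem_lead_inr, reducedSystem_tail_inr, map_add, lift_linWord, AlgHom.commutes,
      ← hf]
    simp

/-- Restricted monomials span. -/
theorem prod_mem_span_restricted (hf : ∀ x, f x ^ p - f (pm x) = algebraMap F A (S x ^ p))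
    (w : List ι) :
    (w.map fun i => f (e i)).prod ∈ Submodule.span F
      (Set.range fun v : {v : List ι // IsRestrictedWord p v} =>
        (v.1.map fun i => f (e i)).prod) := by
  -- A word that is not restricted contains a leading word; replacing it by the tail leaves smaller
  -- words.
  induction w using (reducedSystem e p pm S).wf.induction with
  | _ w ih =>
    by_cases hw : IsRestrictedWord p w
    · exact Submodule.subset_span ⟨⟨w, hw⟩, rfl⟩
    rw [← reducedSystem_irreducible_iff e pm S] at hw
    simp only [RewritingSystem.Irreducible, not_forall, not_not] at hw
    obtain ⟨s, x, y, h⟩ := hw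
    set φ := FreeAlgebra.lift F (fun i => f (e i)) with hφ
    have h₁ : φ (freeWord F w) =
        φ (freeWord F x * (reducedSystem e p pm S).tail s * freeWord F y) := by
      have := lift_reducedSystem_rel e f hf s
      rw [RewritingSystem.rel, map_sub, sub_eq_zero] at this
      rw [h, freeWord_append, freeWord_append, map_mul, map_mul, hφ, this, map_mul, map_mul]
    rw [← lift_freeWord, ← hφ, h₁]
    have hm := (reducedSystem e p pm S).mul_tail_mul_mem s x y
    rw [← h] at hm
    generalize freeWord F x * (reducedSystem e p pm S).tail s * freeWord F y = m at hm
    induction hm using Submodule.span_induction with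
    | mem m hm =>
      obtain ⟨v, hv, rfl⟩ := hm
      rw [hφ, lift_freeWord]
      exact ih v hv
    | zero => simp
    | add a b _ _ ha hb => rw [map_add]; exact add_mem ha hb
    | smul c a _ ha => rw [map_smul]; exact Submodule.smul_mem _ _ ha

end Evaluation

/-- The largest two-sided ideal in the kernel of the normal form map. -/
noncomputable def RewritingSystem.nfIdeal {F ι σ : Type*} [Field F]
    (W : RewritingSystem F ι σ) : Ideal (FreeAlgebra F ι) where
  carrier := {r | ∀ x y, W.nf (x * r * y) = 0}
  zero_mem' := by simp
  add_mem' {a b} ha hb x y := by rw [mul_add, add_mul, map_add, ha, hb, add_zero]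
  smul_mem' c a ha x y := by rw [smul_eq_mul, ← mul_assoc]; exact ha _ _

instance RewritingSystem.nfIdeal_isTwoSided {F ι σ : Type*} [Field F]
    (W : RewritingSystem F ι σ) : W.nfIdeal.IsTwoSided where
  mul_mem_of_left {a} b ha x y := by
    rw [← mul_assoc, mul_assoc _ b]
    exact ha x (b * y)

theorem RewritingSystem.Confluent.rel_mem_nfIdeal {F ι σ : Type*} [Field F]
    {W : RewritingSystem F ι σ} (hW : W.Confluent) (s : σ) : W.rel s ∈ W.nfIdeal := by
  intro x y
  have hx := (freeWordBasis F ι).mem_span x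
  have hy := (freeWordBasis F ι).mem_span y
  induction hx using Submodule.span_induction with
  | mem x hx =>
    obtain ⟨x, rfl⟩ := hx
    induction hy using Submodule.span_induction with
    | mem y hy =>
      obtain ⟨y, rfl⟩ := hy
      rw [freeWordBasis_apply, freeWordBasis_apply]
      exact hW.nf_rel s x y
    | zero => simp
    | add a b _ _ ha hb => rw [mul_add, map_add, ha, hb, add_zero]
    | smul c a _ ha => rw [mul_smul_comm, map_smul, ha, smul_zero]
  | zero => simp
  | add a b _ _ ha hb => rw [add_mul, add_mul, map_add, ha, hb, add_zero]
  | smul c a _ ha => rw [smul_mul_assoc, smul_mul_assoc, map_smul, ha, smul_zero]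

theorem RewritingSystem.Confluent.below_le_nfIdeal {F ι σ : Type*} [Field F]
    {W : RewritingSystem F ι σ} (hW : W.Confluent) {w : List ι} {r : FreeAlgebra F ι}
    (hr : r ∈ W.below w) : r ∈ W.nfIdeal := by
  induction hr using Submodule.span_induction with
  | mem r h =>
    obtain ⟨s, x, y, -, rfl⟩ := h
    exact Ideal.mul_mem_right _ _ (Ideal.mul_mem_left _ _ (hW.rel_mem_nfIdeal s))
  | zero => exact zero_mem _
  | add a b _ _ ha hb => exact add_mem ha hb
  | smul c a _ ha => rw [Algebra.smul_def]; exact Ideal.mul_mem_left _ _ ha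

/-- Members of the ideal are killed by `nf`, which fixes irreducible words; a dependence in the
quotient is thus already one between words in the free algebra. -/
theorem RewritingSystem.linearIndependent_irreducible {F ι σ : Type*} [Field F]
    (W : RewritingSystem F ι σ) {P : List ι → Prop} (hP : ∀ w, P w → W.Irreducible w) :
    LinearIndependent F fun w : {w // P w} =>
      Ideal.Quotient.mkₐ F W.nfIdeal (freeWord F w.1) := by
  have hli : LinearIndependent F fun w : {w // P w} => freeWord F w.1 := by
    have := (freeWordBasis F ι).linearIndependent.comp (Subtype.val : {w // P w} → List ι)
      Subtype.val_injective
    simpa [Function.comp_def] using this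
  rw [linearIndependent_iff] at hli ⊢
  intro l hl
  apply hli
  have h₁ : Ideal.Quotient.mkₐ F W.nfIdeal
      (Finsupp.linearCombination F (fun w : {w // P w} => freeWord F w.1) l) = 0 := by
    rw [← hl]
    exact Finsupp.apply_linearCombination F (Ideal.Quotient.mkₐ F W.nfIdeal).toLinearMap _ l
  rw [Ideal.Quotient.mkₐ_eq_mk, Ideal.Quotient.eq_zero_iff_mem] at h₁
  have h₂ := h₁ 1 1
  rw [one_mul, mul_one, Finsupp.apply_linearCombination] at h₂
  rw [← h₂]
  congr 2
  funext w
  exact (W.nf_of_irreducible (hP _ w.2)).symm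

variable [CharP F p] {pm : L → L} (S : Module.Dual F L)
  (e : Module.Basis ι F L)

theorem linWord_lie_mem_nfIdeal (hpm : IsPMapping F p pm) (u v : L) :
    linWord e u * linWord e v - linWord e v * linWord e u - linWord e ⁅u, v⁆ ∈
      (reducedSystem e p pm S).nfIdeal := by
  rcases isEmpty_or_nonempty ι with h | ⟨⟨i⟩⟩
  · have := e.repr.toEquiv.subsingleton
    rw [Subsingleton.elim u 0]
    simp
  -- Any word longer than two letters serves as a bound; `[i, i, i]` is one as soon as there is a
  -- letter.
  · have := reducedSystem_lie_mem e (p := p) pm S u v (x := []) (y := []) (w := [i, i, i]) (by simp)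
    have := (reducedSystem_confluent S hpm).below_le_nfIdeal this
    simpa using this

/-- The Lie algebra homomorphism from `L` to the quotient by the normal form ideal. -/
noncomputable def toNfQuotient (hpm : IsPMapping F p pm) :
    L →ₗ⁅F⁆ (FreeAlgebra F ι ⧸ (reducedSystem e p pm S).nfIdeal) where
  toLinearMap := (Ideal.Quotient.mkₐ F (reducedSystem e p pm S).nfIdeal).toLinearMap ∘ₗ linWord e
  map_lie' {u v} := by
    have := linWord_lie_mem_nfIdeal S e hpm u v
    rw [← Ideal.Quotient.eq_zero_iff_mem, map_sub, sub_eq_zero] at this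
    change Ideal.Quotient.mk _ (linWord e ⁅u, v⁆) = _
    rw [← this, map_sub, map_mul, map_mul]
    rfl

theorem toNfQuotient_basis (hpm : IsPMapping F p pm) (i : ι) :
    toNfQuotient S e hpm (e i) = Ideal.Quotient.mkₐ F _ (freeWord F [i]) := by
  rw [← linWord_basis e]; rfl

/-- The power rules give the relation on basis vectors only; Jacobson's formula carries it to all of
`L`. -/
theorem toNfQuotient_pow_sub (hpm : IsPMapping F p pm) (x : L) :
    toNfQuotient S e hpm x ^ p - toNfQuotient S e hpm (pm x) = algebraMap F _ (S x ^ p) := by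
  refine hpm.pow_sub_of_span S _ e.span_eq ?_ x
  rintro _ ⟨i, rfl⟩
  have := (reducedSystem_confluent (e := e) S hpm).rel_mem_nfIdeal (Sum.inr i)
  rw [RewritingSystem.rel, reducedSystem_lead_inr, reducedSystem_tail_inr, freeWord_replicate,
    ← Ideal.Quotient.eq_zero_iff_mem, ← sub_sub, map_sub, sub_eq_zero, map_sub, map_pow] at this
  rw [toNfQuotient_basis]
  exact this

/-- Independence is tested after mapping to the quotient by `nfIdeal`, where these monomials become
classes of irreducible words. -/
theorem linearIndependent_restricted_monomials (hpm : IsPMapping F p pm) :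
    LinearIndependent F fun w : {w : List ι // IsRestrictedWord p w} =>
      (w.1.map fun i => ReducedEnveloping.ι p pm S (e i)).prod := by
  have h := (reducedSystem e p pm S).linearIndependent_irreducible
    (P := IsRestrictedWord p) (fun w hw => (reducedSystem_irreducible_iff e pm S).mpr hw)
  refine LinearIndependent.of_comp
    (ReducedEnveloping.lift (toNfQuotient S e hpm) (toNfQuotient_pow_sub S e hpm)).toLinearMap ?_
  convert! h using 1
  funext w
  simp only [Function.comp_apply, AlgHom.toLinearMap_apply]
  rw [map_list_prod, List.map_map, freeWord, map_list_prod, List.map_map]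
  congr 1
  refine List.map_congr_left fun i _ => ?_
  simp only [Function.comp_apply]
  rw [ReducedEnveloping.lift_ι, toNfQuotient_basis]
  simp [freeWord]

end ReducedPBW

/-! ### Generation and dimension of `u(L, S)`. -/

section Generation

attribute [local instance 100] LieRing.ofAssociativeRing

variable {F L : Type*} [Field F] [LieRing L] [LieAlgebra F L] (p : ℕ) (pm : L → L)
  (S : Module.Dual F L)

theorem ReducedEnveloping.adjoin_range_ι :
    Algebra.adjoin F (Set.range (ReducedEnveloping.ι p pm S)) = ⊤ := by
  have h₁ : Algebra.adjoin F (Set.range (UniversalEnvelopingAlgebra.ι F (L := L))) = ⊤ := by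
    have : Set.range (UniversalEnvelopingAlgebra.ι F (L := L)) =
        UniversalEnvelopingAlgebra.mkAlgHom F L '' Set.range (TensorAlgebra.ι F (M := L)) := by
      rw [← Set.range_comp]; rfl
    rw [this, ← AlgHom.map_adjoin, TensorAlgebra.adjoin_range_ι, Algebra.map_top,
      AlgHom.range_eq_top]
    exact RingCon.mkₐ_surjective (UniversalEnvelopingAlgebra.ringCon F L)
  have : Set.range (ReducedEnveloping.ι p pm S) = RingQuot.mkAlgHom F (ReducedRel p pm S) ''
      Set.range (UniversalEnvelopingAlgebra.ι F (L := L)) := by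
    rw [← Set.range_comp]; rfl
  rw [this, ← AlgHom.map_adjoin, h₁, Algebra.map_top, AlgHom.range_eq_top]
  exact RingQuot.mkAlgHom_surjective F _

theorem span_restricted_monomials {ι : Type*} [LinearOrder ι] [WellFoundedLT ι]
    [hp : Fact p.Prime] (e : Module.Basis ι F L) :
    Submodule.span F (Set.range fun w : {w : List ι // IsRestrictedWord p w} =>
      (w.1.map fun i => ReducedEnveloping.ι p pm S (e i)).prod) = ⊤ := by
  have hs : Function.Surjective
      (FreeAlgebra.lift F (fun i => ReducedEnveloping.ι p pm S (e i))) := by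
    rw [← AlgHom.range_eq_top, ← top_le_iff, ← ReducedEnveloping.adjoin_range_ι p pm S,
      Algebra.adjoin_le_iff]
    rintro _ ⟨x, rfl⟩
    exact ⟨linWord e x, lift_linWord e (ReducedEnveloping.ι p pm S) x⟩
  rw [eq_top_iff]
  rintro x -
  obtain ⟨r, rfl⟩ := hs x
  have hr := (freeWordBasis F ι).mem_span r
  induction hr using Submodule.span_induction with
  | mem r hr =>
    obtain ⟨w, rfl⟩ := hr
    rw [freeWordBasis_apply, lift_freeWord]
    exact prod_mem_span_restricted e _ (ReducedEnveloping.ι_pow_sub p pm S) w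
  | zero => simp
  | add a b _ _ ha hb => rw [map_add]; exact add_mem ha hb
  | smul c a _ ha => rw [map_smul]; exact Submodule.smul_mem _ _ ha

variable {p pm}

/-- The PBW basis of the reduced enveloping algebra. -/
noncomputable def reducedPBWBasis {ι : Type*} [LinearOrder ι] [WellFoundedLT ι]
    [hp : Fact p.Prime] [CharP F p] (hpm : IsPMapping F p pm) (e : Module.Basis ι F L) :
    Module.Basis {w : List ι // IsRestrictedWord p w} F (ReducedEnveloping p pm S) :=
  Module.Basis.mk (linearIndependent_restricted_monomials S e hpm)
    (span_restricted_monomials p pm S e).ge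

theorem finiteDimensional_reducedEnveloping [Fact p.Prime] [FiniteDimensional F L] :
    FiniteDimensional F (ReducedEnveloping p pm S) :=
  .of_fg_top ⟨(Set.finite_range _).toFinset, by
    rw [Set.Finite.coe_toFinset]
    exact span_restricted_monomials p pm S (Module.finBasis F L)⟩

/-- Spanning alone gives this bound. It is all that is needed for `H`, so the restricted map need
not be shown to be a `p`-mapping. -/
theorem finrank_reducedEnveloping_le [Fact p.Prime] [FiniteDimensional F L] :
    Module.finrank F (ReducedEnveloping p pm S) ≤ p ^ Module.finrank F L := by
  have := Fintype.ofFinite {w : List (Fin (Module.finrank F L)) // IsRestrictedWord p w}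
  have h := finrank_range_le_card (R := F) (fun w : {w : List _ // IsRestrictedWord p w} =>
    (w.1.map fun i => ReducedEnveloping.ι p pm S (Module.finBasis F L i)).prod)
  rwa [Set.finrank, span_restricted_monomials, finrank_top, ← Nat.card_eq_fintype_card,
    card_isRestrictedWord, Nat.card_eq_fintype_card, Fintype.card_fin] at h

theorem finrank_reducedEnveloping [Fact p.Prime] [CharP F p] [FiniteDimensional F L]
    (hpm : IsPMapping F p pm) :
    Module.finrank F (ReducedEnveloping p pm S) = p ^ Module.finrank F L := by
  rw [Module.finrank_eq_nat_card_basis (reducedPBWBasis S hpm (Module.finBasis F L)),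
    card_isRestrictedWord, Nat.card_eq_fintype_card, Fintype.card_fin]

end Generation

/-! ### Tensor products with a free right module. -/

section TensorOverFree

variable {F A B M T : Type*} [Field F] [Ring A] [Algebra F A] [Ring B] [Algebra F B]
  [AddCommGroup M] [Module F M] [Fintype T]

/-- The map `b ↦ ∑ g_t φ(b_t)` from a free right `B`-module. -/
def freeRightMap (φ : B →ₐ[F] A) (g : T → A) : (T → B) →ₗ[F] A where
  toFun b := ∑ t, g t * φ (b t)
  map_add' b c := by simp [mul_add, Finset.sum_add_distrib]
  map_smul' r b := by simp [Finset.smul_sum]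

theorem freeRightMap_apply (φ : B →ₐ[F] A) (g : T → A) (b : T → B) :
    freeRightMap φ g b = ∑ t, g t * φ (b t) := rfl

theorem freeRightMap_mul (φ : B →ₐ[F] A) (g : T → A) (b : T → B) (c : B) :
    freeRightMap φ g (fun t => b t * c) = freeRightMap φ g b * φ c := by
  simp [freeRightMap_apply, Finset.sum_mul, mul_assoc]

theorem freeRightMap_single [DecidableEq T] (φ : B →ₐ[F] A) (g : T → A) (t : T) :
    freeRightMap φ g (Pi.single t 1) = g t := by
  rw [freeRightMap_apply, Finset.sum_eq_single t]
  · simp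
  · intro s _ h
    simp [Pi.single_eq_of_ne h]
  · simp

/-- If `A` is free as a right `B`-module on `g`, then `A ⊗_B M` is a direct sum of copies
of `M`. -/
theorem nonempty_tensorOver_equiv (φ : B →ₐ[F] A) (ρ : B →ₐ[F] Module.End F M) (g : T → A)
    (hg : Function.Bijective (freeRightMap φ g)) :
    Nonempty ((T → M) ≃ₗ[F] TensorOver φ ρ) := by
  classical
  set c : A ≃ₗ[F] (T → B) := (LinearEquiv.ofBijective (freeRightMap φ g) hg).symm with hc
  have hc₁ : ∀ a, ∑ t, g t * φ (c a t) = a := fun a =>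
    (LinearEquiv.ofBijective (freeRightMap φ g) hg).apply_symm_apply a
  have hc₂ : ∀ a b t, c (a * φ b) t = c a t * b := by
    intro a b t
    have : c (a * φ b) = fun t => c a t * b := by
      apply hg.1
      rw [freeRightMap_mul, freeRightMap_apply, freeRightMap_apply, hc₁, hc₁]
    rw [this]
  have hc₃ : ∀ t, c (g t) = Pi.single t 1 := by
    intro t
    apply hg.1
    rw [freeRightMap_single, freeRightMap_apply, hc₁]
  -- Coordinates of `a` act on `m`. Since `fwd` kills the balanced relations and undoes `bwd`, it
  -- proves injectivity of `bwd`.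
  let fwd : A ⊗[F] M →ₗ[F] (T → M) := TensorProduct.lift (LinearMap.mk₂ F
    (fun a m t => ρ (c a t) m)
    (fun a a' m => by funext t; simp)
    (fun r a m => by funext t; simp)
    (fun a m m' => by funext t; simp)
    (fun r a m => by funext t; simp))
  have hfwd : ∀ a m, fwd (a ⊗ₜ m) = fun t => ρ (c a t) m := fun a m => rfl
  have hker : ∀ x ∈ balancedRelations φ ρ, fwd x = 0 := by
    intro x hx
    have hx' : x ∈ (balancedRelations φ ρ).restrictScalars F := hx
    rw [balancedRelations_restrictScalars] at hx'
    have hle : Submodule.span F {t | ∃ (a : A) (b : B) (m : M),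
        t = (a * φ b) ⊗ₜ[F] m - a ⊗ₜ[F] (ρ b m)} ≤ LinearMap.ker fwd := by
      rw [Submodule.span_le]
      rintro _ ⟨a, b, m, rfl⟩
      rw [SetLike.mem_coe, LinearMap.mem_ker, map_sub, hfwd, hfwd, sub_eq_zero]
      funext t
      rw [hc₂, map_mul, Module.End.mul_apply]
    exact hle hx'
  let bwd : (T → M) →ₗ[F] TensorOver φ ρ :=
    ((balancedRelations φ ρ).mkQ.restrictScalars F) ∘ₗ
      (∑ t, (TensorProduct.mk F A M (g t)) ∘ₗ (LinearMap.proj t : (T → M) →ₗ[F] M))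
  have hbwd : ∀ f, bwd f = (balancedRelations φ ρ).mkQ (∑ t, g t ⊗ₜ[F] f t) := by
    intro f; simp [bwd]
  refine ⟨LinearEquiv.ofBijective bwd ⟨?_, ?_⟩⟩
  · rw [injective_iff_map_eq_zero]
    intro f hf
    rw [hbwd, Submodule.mkQ_apply, Submodule.Quotient.mk_eq_zero] at hf
    have := hker _ hf
    rw [map_sum] at this
    funext s
    have h := congrFun this s
    rw [Finset.sum_apply, Finset.sum_eq_single s] at h
    · simpa [hfwd, hc₃] using h
    · intro t _ hts
      simp [hfwd, hc₃, Pi.single_eq_of_ne hts.symm]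
    · simp
  · intro x
    obtain ⟨x, rfl⟩ := Submodule.mkQ_surjective _ x
    induction x using TensorProduct.induction_on with
    | zero => exact ⟨0, by simp⟩
    | add x y hx hy =>
      obtain ⟨f, hf⟩ := hx
      obtain ⟨f', hf'⟩ := hy
      exact ⟨f + f', by rw [map_add, hf, hf', map_add]⟩
    | tmul a m =>
      refine ⟨fun t => ρ (c a t) m, ?_⟩
      rw [hbwd]
      nth_rw 2 [← hc₁ a]
      rw [TensorProduct.sum_tmul, map_sum, map_sum]
      refine Finset.sum_congr rfl fun t _ => ?_
      rw [eq_comm, ← sub_eq_zero, ← map_sub, Submodule.mkQ_apply, Submodule.Quotient.mk_eq_zero]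
      exact Submodule.subset_span ⟨g t, c a t, m, rfl⟩

end TensorOverFree

/-! ### Freeness of `u(L, S)` over `u(H, S|_H)` and the dimension of the induced module. -/

section Induced

attribute [local instance 100] LieRing.ofAssociativeRing

variable {F L : Type*} [Field F] [LieRing L] [LieAlgebra F L]
  {p : ℕ} {pm : L → L}

theorem reducedInclusion_ι (S : Module.Dual F L) {H : LieSubalgebra F L}
    (hH : IsPSubalgebra pm H) (x : H) :
    reducedInclusion p S hH (ReducedEnveloping.ι p hH.restrict (restrictForm S H) x) =
      ReducedEnveloping.ι p pm S (x : L) :=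
  ReducedEnveloping.lift_ι _ _ x

/-- `u(L, S)` is free as a right `u(H, S|_H)`-module, with a basis of restricted monomials in a
complement of `H`. -/
theorem exists_freeRightMap_bijective [FiniteDimensional F L] [Fact p.Prime] [CharP F p]
    (hpm : IsPMapping F p pm) (S : Module.Dual F L)
    (H : LieSubalgebra F L) (hH : IsPSubalgebra pm H) :
    ∃ g : {w : List (Fin (Module.finrank F (L ⧸ H.toSubmodule))) // IsRestrictedWord p w} →
        ReducedEnveloping p pm S,
      ∀ [Fintype {w : List (Fin (Module.finrank F (L ⧸ H.toSubmodule))) // IsRestrictedWord p w}],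
        Function.Bijective (freeRightMap (reducedInclusion p S hH) g) := by
  let bH : Module.Basis (Fin (Module.finrank F H)) F H.toSubmodule := Module.finBasis F H
  -- The summands are exchanged so that lifts of `L/H` come first. In a sorted monomial the letters
  -- from `H` then stand on the right, where `u(H, S|_H)` acts.
  let e := ((bH.sumQuot (Module.finBasis F (L ⧸ H.toSubmodule))).reindex
    (Equiv.sumComm _ _)).reindex toLex
  have he : ∀ j, e (toLex (Sum.inr j)) = (bH j : L) := by
    intro j; simp [e]
  refine ⟨fun w => (w.1.map fun i => ReducedEnveloping.ι p pm S (e (toLex (Sum.inl i)))).prod, ?_⟩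
  intro _
  set Φ := freeRightMap (reducedInclusion p S hH)
    (fun w : {w : List (Fin (Module.finrank F (L ⧸ H.toSubmodule))) // IsRestrictedWord p w} =>
      (w.1.map fun i => ReducedEnveloping.ι p pm S (e (toLex (Sum.inl i)))).prod) with hΦ
  have hsurj : Function.Surjective Φ := by
    classical
    rw [← LinearMap.range_eq_top, ← top_le_iff, ← span_restricted_monomials p pm S e,
      Submodule.span_le]
    rintro _ ⟨⟨w, hw⟩, rfl⟩
    obtain ⟨v, u, hv, rfl⟩ := hw.exists_append
    refine ⟨fun t => (Pi.single (⟨v, hv⟩ : {w // IsRestrictedWord p w}) 1 :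
      _ → ReducedEnveloping p hH.restrict (restrictForm S H)) t *
        (u.map fun j => ReducedEnveloping.ι p hH.restrict (restrictForm S H) (bH j)).prod, ?_⟩
    rw [hΦ, freeRightMap_mul, freeRightMap_single]
    simp only [List.map_append, List.prod_append, List.map_map, map_list_prod]
    congr 2
    refine List.map_congr_left fun j _ => ?_
    simp only [Function.comp_apply]
    rw [he]
    exact reducedInclusion_ι S hH _
  have := finiteDimensional_reducedEnveloping (pm := pm) (p := p) S
  have := finiteDimensional_reducedEnveloping (pm := hH.restrict) (p := p) (restrictForm S H)
  -- The source has dimension at most `p^(dim L/H) · p^(dim H) = p^(dim L)`, the dimension of the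
  -- target, so the surjection is bijective.
  have hsrc : Module.finrank F ({w : List (Fin (Module.finrank F (L ⧸ H.toSubmodule))) //
      IsRestrictedWord p w} → ReducedEnveloping p hH.restrict (restrictForm S H)) ≤
        Module.finrank F (ReducedEnveloping p pm S) := by
    rw [finrank_reducedEnveloping S hpm, Module.finrank_pi_fintype, Finset.sum_const,
      Finset.card_univ, ← Nat.card_eq_fintype_card, card_isRestrictedWord,
      Nat.card_eq_fintype_card, Fintype.card_fin, smul_eq_mul,
      ← H.toSubmodule.finrank_quotient_add_finrank, pow_add]
    exact Nat.mul_le_mul_left _ (finrank_reducedEnveloping_le _)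
  have heq := le_antisymm hsrc (LinearMap.finrank_le_finrank_of_surjective hsurj)
  exact ⟨(LinearMap.injective_iff_surjective_of_finrank_eq_finrank heq).mpr hsurj, hsurj⟩

end Induced

theorem mainTheorem7 {F L M : Type*} [Field F] {p : ℕ} [Fact p.Prime] [CharP F p]
    [LieRing L] [LieAlgebra F L] [FiniteDimensional F L]
    {pm : L → L} (hpm : IsPMapping F p pm) (S : Module.Dual F L)
    (H : LieSubalgebra F L) (hH : IsPSubalgebra pm H)
    [AddCommGroup M] [Module F M] [FiniteDimensional F M]
    [LieRingModule H M] [LieModule F H M]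
    (hM : HasCharacter p hH.restrict (restrictForm S H) M) :
    FiniteDimensional F (InducedModule S hH hM) ∧
      Module.finrank F (InducedModule S hH hM) =
        p ^ Module.finrank F (L ⧸ H.toSubmodule) * Module.finrank F M := by
  have := Fintype.ofFinite
    {w : List (Fin (Module.finrank F (L ⧸ H.toSubmodule))) // IsRestrictedWord p w}
  obtain ⟨g, hg⟩ := exists_freeRightMap_bijective hpm S H hH
  obtain ⟨E⟩ := nonempty_tensorOver_equiv (reducedInclusion p S hH) hM.action g hg
  refine ⟨Module.Finite.equiv E, ?_⟩
  rw [← E.finrank_eq, Module.finrank_pi_fintype, Finset.sum_const, Finset.card_univ,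
    ← Nat.card_eq_fintype_card, card_isRestrictedWord, Nat.card_eq_fintype_card, Fintype.card_fin,
    smul_eq_mul]
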